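/- Let $K$ be a field whose characteristic is not $2$, $3$ or $7$, let $s\in K$, and set \begin{align*} c_4 &= -31\,(s^4 + 42 s^2 - 147) + \tfrac{32200}{3}\, s,\\ c_2 &= 2^8\bigl(s^8 + 84 s^6 - \tfrac{3472}{3} s^5 + 1470 s^4 - 48608 s^3 + 53508 s^2 + 170128 s + 21609\bigr),\\ c_0 &= \tfrac{2^{20}\cdot 7}{3}\, s\,(s^2+7)^3 (s^2+63),\\ d &= s^4 + 42 s^2 + \tfrac{1736}{3} s - 147. \end{align*} Suppose $c_0 d\neq 0$. Then the equation $$d y^2 = x^6 + c_4 x^4 + c_2 x^2 + c_0$$ defines a nonsingular genus-$2$ curve $C_{24}^s$ over $K$, and the Jacobian of $C_{24}^s$ has a $K$-rational torsion point of order $24$. -/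

import Mathlib

open Polynomial

noncomputable section

/-! ## Places, divisors, divisor classes and differentials of a function field

Throughout, `F` is thought of as the function field of a complete nonsingular curve over `k`
(a finitely generated field extension of `k` of transcendence degree one).  The closed points of
the curve are the places of `F` over `k`. -/

/-- A place of `F` over `k`: a normalized discrete valuation of `F` (in multiplicative notation,
with value group `ℤ`) which is trivial on the constants. -/
@[ext]
structure Place (k F : Type*) [Field k] [CommRing F] [Algebra k F] where
  val : Valuation F (WithZero (Multiplicative ℤ))
  surj : Function.Surjective val
  map_const : ∀ c : k, c ≠ 0 → val (algebraMap k F c) = 1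

namespace Place

variable {k F : Type*} [Field k] [CommRing F] [Algebra k F]

/-- The order of vanishing of `f ≠ 0` at the place `P` (negative at a pole). -/
def ord (P : Place k F) (f : F) : ℤ := -WithZero.log (P.val f)

theorem val_unit_ne_zero (P : Place k F) (f : Fˣ) : P.val (f : F) ≠ 0 := by
  intro h
  have h1 : P.val ((f : F) * ((f⁻¹ : Fˣ) : F)) = 0 := by rw [map_mul, h, zero_mul]
  rw [Units.mul_inv, map_one] at h1
  exact one_ne_zero h1

theorem ord_mul (P : Place k F) (f g : Fˣ) :
    P.ord ((f * g : Fˣ) : F) = P.ord (f : F) + P.ord (g : F) := by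
  unfold ord
  rw [Units.val_mul, map_mul, WithZero.log_mul (P.val_unit_ne_zero f) (P.val_unit_ne_zero g)]
  ring

theorem ord_one (P : Place k F) : P.ord (1 : F) = 0 := by
  simp [ord]

theorem ord_inv (P : Place k F) (f : Fˣ) : P.ord ((f⁻¹ : Fˣ) : F) = -P.ord (f : F) := by
  have h := P.ord_mul f f⁻¹
  rw [mul_inv_cancel, Units.val_one, P.ord_one] at h
  linarith

theorem val_smul_le (P : Place k F) (c : k) (f : F) : P.val (c • f) ≤ P.val f := by
  by_cases hc : c = 0
  · simp [hc]
  · rw [Algebra.smul_def, map_mul, P.map_const c hc, one_mul]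

/-- The valuation ring of `P`, as a `k`-subspace of `F`. -/
def integers (P : Place k F) : Submodule k F where
  carrier := {f | P.val f ≤ 1}
  add_mem' ha hb := P.val.map_add_le ha hb
  zero_mem' := by simp
  smul_mem' c f hf := (P.val_smul_le c f).trans hf

/-- The maximal ideal of the valuation ring of `P`, as a `k`-subspace of `F`. -/
def maximal (P : Place k F) : Submodule k F where
  carrier := {f | P.val f < 1}
  add_mem' ha hb := P.val.map_add_lt ha hb
  zero_mem' := by simp
  smul_mem' c f hf := (P.val_smul_le c f).trans_lt hf

/-- The degree of `P`: the dimension over `k` of its residue field. -/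
def degree (P : Place k F) : ℕ :=
  Module.finrank k (P.integers ⧸ P.maximal.submoduleOf P.integers)

end Place

section Divisors

variable (k F : Type*) [Field k] [CommRing F] [Algebra k F]

/-- Divisors: finite formal integral combinations of places. -/
abbrev Divisor := Place k F →₀ ℤ

/-- The degree of a divisor. -/
def Divisor.degree : Divisor k F →+ ℤ :=
  Finsupp.liftAddHom fun P => AddMonoidHom.mulRight (P.degree : ℤ)

/-- The group of principal divisors, i.e. divisors of invertible functions. -/
def Divisor.principal : AddSubgroup (Divisor k F) where
  carrier := {D | ∃ f : Fˣ, ∀ P, D P = P.ord (f : F)}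
  add_mem' := by
    rintro _ _ ⟨f, hf⟩ ⟨g, hg⟩
    exact ⟨f * g, fun P => by rw [Finsupp.add_apply, hf, hg, P.ord_mul]⟩
  zero_mem' := ⟨1, fun P => by rw [Units.val_one, P.ord_one, Finsupp.zero_apply]⟩
  neg_mem' := by
    rintro _ ⟨f, hf⟩
    exact ⟨f⁻¹, fun P => by rw [Finsupp.neg_apply, hf, P.ord_inv]⟩

/-- The group of divisor classes. -/
abbrev DivisorClass := Divisor k F ⧸ Divisor.principal k F

/-- The group `Pic⁰` of classes of divisors of degree zero. -/
def DivisorClass.degreeZero : AddSubgroup (DivisorClass k F) :=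
  (Divisor.degree k F).ker.map (QuotientAddGroup.mk' (Divisor.principal k F))

/-- The space of regular differentials: those Kähler differentials `ω` of `F` over `k` that at
each place `P` lie in the `𝒪_P`-module generated by the `df` with `f ∈ 𝒪_P`. -/
def regularDifferentials : Submodule k (Ω[F⁄k]) :=
  ⨅ P : Place k F, Submodule.span k
    {ω | ∃ g ∈ P.integers, ∃ f ∈ P.integers, ω = g • KaehlerDifferential.D k F f}

/-- The genus: the dimension of the space of regular differentials. -/
def genus : ℕ := Module.finrank k (regularDifferentials k F)

/-- A ring automorphism of `F` which is semilinear over an automorphism of `k`. -/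
structure SemilinearAut where
  onConst : k ≃+* k
  toEquiv : F ≃+* F
  compat : ∀ c : k, toEquiv (algebraMap k F c) = algebraMap k F (onConst c)

end Divisors

namespace SemilinearAut

variable {k F : Type*} [Field k] [CommRing F] [Algebra k F]

/-- The inverse automorphism. -/
def symm (e : SemilinearAut k F) : SemilinearAut k F where
  onConst := e.onConst.symm
  toEquiv := e.toEquiv.symm
  compat c := by
    rw [RingEquiv.symm_apply_eq, e.compat, RingEquiv.apply_symm_apply]

/-- Transport of a place along an automorphism. -/
def comapPlace (e : SemilinearAut k F) (P : Place k F) : Place k F where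
  val := P.val.comap (e.toEquiv : F →+* F)
  surj := P.surj.comp e.toEquiv.surjective
  map_const c hc := by
    have hc' : e.onConst c ≠ 0 := by simpa using hc
    simpa [e.compat] using P.map_const _ hc'

/-- The permutation of the places induced by an automorphism. -/
def placeEquiv (e : SemilinearAut k F) : Place k F ≃ Place k F where
  toFun := e.comapPlace
  invFun := e.symm.comapPlace
  left_inv P := by
    ext f
    simp [comapPlace, symm]
  right_inv P := by
    ext f
    simp [comapPlace, symm]

/-- The induced action on divisors. -/
def divisorMap (e : SemilinearAut k F) : Divisor k F →+ Divisor k F :=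
  (Finsupp.domCongr e.placeEquiv).toAddMonoidHom

theorem principal_le (e : SemilinearAut k F) :
    Divisor.principal k F ≤ (Divisor.principal k F).comap e.divisorMap := by
  rintro D ⟨f, hf⟩
  refine ⟨Units.mapEquiv e.toEquiv.symm.toMulEquiv f, fun P => ?_⟩
  change D (e.symm.comapPlace P) = _
  rw [hf]
  rfl

/-- The induced action on divisor classes. -/
def classMap (e : SemilinearAut k F) : DivisorClass k F →+ DivisorClass k F :=
  QuotientAddGroup.map _ _ e.divisorMap e.principal_le

end SemilinearAut

/-! ## The curves `d y² = a₀ + a₁ x + ⋯ + a₆ x⁶` -/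

/-- The data of an equation `d y² = a₀ + a₁ x + ⋯ + a₆ x⁶` over `K`. -/
@[ext]
structure SexticModel (K : Type*) [Field K] where
  d : K
  a : Fin 7 → K

namespace SexticModel

variable {K L : Type*} [Field K] [Field L]

/-- The right-hand side `a₀ + a₁ x + ⋯ + a₆ x⁶`. -/
def sextic (C : SexticModel K) : K[X] := ∑ i : Fin 7, Polynomial.C (C.a i) * X ^ (i : ℕ)

/-- The chart at infinity `d v² = a₀ u⁶ + a₁ u⁵ + ⋯ + a₆`, where `u = 1 / x` and
`v = y / x³`. -/
def atInfinity (C : SexticModel K) : SexticModel K := ⟨C.d, C.a ∘ Fin.rev⟩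

/-- Transport of the coefficients along a homomorphism of fields. -/
def map (φ : K →+* L) (C : SexticModel K) : SexticModel L := ⟨φ C.d, φ ∘ C.a⟩

/-- The polynomial `d Y² - (a₀ + a₁ X + ⋯ + a₆ X⁶)` in `K[X][Y]`. -/
def equation (C : SexticModel K) : K[X][X] :=
  Polynomial.C (Polynomial.C C.d) * X ^ 2 - Polynomial.C C.sextic

/-- The coordinate ring `K[x, y] / (d y² - (a₀ + a₁ x + ⋯ + a₆ x⁶))`. -/
abbrev CoordinateRing (C : SexticModel K) := AdjoinRoot C.equation

/-- The function field (when the coordinate ring is a domain). -/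
abbrev FunctionField (C : SexticModel K) := FractionRing C.CoordinateRing

/-- The Jacobian criterion for the affine curve `d y² = a₀ + a₁ x + ⋯ + a₆ x⁶`: the two partial
derivatives of the equation have no common zero on the curve over an algebraic closure. -/
def AffineNonsingular (C : SexticModel K) : Prop :=
  ∀ x y : AlgebraicClosure K,
    algebraMap K (AlgebraicClosure K) C.d * y ^ 2 = aeval x C.sextic →
      ¬ (2 * algebraMap K (AlgebraicClosure K) C.d * y = 0 ∧ aeval x (derivative C.sextic) = 0)

/-- The equation defines a nonsingular curve of genus two: the curve is geometrically integral,
its affine part and its chart at infinity (which together cover the complete curve) are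
nonsingular, and its genus is two. -/
structure IsNonsingularGenusTwo (C : SexticModel K) : Prop where
  geometricallyIntegral :
    IsDomain (C.map (algebraMap K (AlgebraicClosure K))).CoordinateRing
  nonsingular : C.AffineNonsingular
  nonsingular_atInfinity : C.atInfinity.AffineNonsingular
  genus_eq : genus K C.FunctionField = 2

theorem sextic_map (φ : K →+* L) (C : SexticModel K) :
    (C.map φ).sextic = C.sextic.map φ := by
  simp [sextic, map, Polynomial.map_sum]

theorem equation_map (φ : K →+* L) (C : SexticModel K) :
    (C.map φ).equation = C.equation.map (mapRingHom φ) := by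
  have h := sextic_map φ C
  have hd : (C.map φ).d = φ C.d := rfl
  simp [equation, h, hd]

/-- An automorphism `σ` of `L` fixing the coefficients of the equation acts on the coordinate
ring, by `σ` on constants and fixing `x` and `y`. -/
def coordinateRingEquiv (C : SexticModel L) (σ : L ≃+* L) (h : C.map (σ : L →+* L) = C) :
    C.CoordinateRing ≃+* C.CoordinateRing :=
  AdjoinRoot.mapRingEquiv (Polynomial.mapEquiv σ) C.equation C.equation (by
    have h1 : C.equation.map ((Polynomial.mapEquiv σ : L[X] ≃+* L[X]) : L[X] →+* L[X])
        = C.equation := by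
      conv_rhs => rw [← h, equation_map]
      rfl
    rw [h1])

/-- The induced semilinear automorphism of the function field. -/
def semilinearAut (C : SexticModel L) (σ : L ≃+* L) (h : C.map (σ : L →+* L) = C) :
    SemilinearAut L C.FunctionField where
  onConst := σ
  toEquiv := IsFractionRing.ringEquivOfRingEquiv (C.coordinateRingEquiv σ h)
  compat c := by
    rw [IsScalarTower.algebraMap_apply L C.CoordinateRing C.FunctionField,
      IsScalarTower.algebraMap_apply L C.CoordinateRing C.FunctionField,
      IsFractionRing.ringEquivOfRingEquiv_algebraMap]
    congr 1
    have hc : ∀ c : L, algebraMap L C.CoordinateRing c =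
        AdjoinRoot.of C.equation (Polynomial.C c) := fun _ => rfl
    rw [hc, hc, coordinateRingEquiv, AdjoinRoot.coe_mapRingEquiv, AdjoinRoot.map_of]
    simp

/-- The base change of the curve to the separable closure of `K`. -/
def sepBaseChange (C : SexticModel K) : SexticModel (SeparableClosure K) :=
  C.map (algebraMap K (SeparableClosure K))

theorem sepBaseChange_map (C : SexticModel K) (σ : SeparableClosure K ≃ₐ[K] SeparableClosure K) :
    C.sepBaseChange.map ((σ : SeparableClosure K ≃+* SeparableClosure K) :
      SeparableClosure K →+* SeparableClosure K) = C.sepBaseChange := by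
  ext <;> simp [sepBaseChange, map]

/-- The action of the absolute Galois group of `K` on the divisor classes of the curve over the
separable closure of `K`. -/
def galoisAction (C : SexticModel K) (σ : SeparableClosure K ≃ₐ[K] SeparableClosure K) :
    DivisorClass (SeparableClosure K) C.sepBaseChange.FunctionField →+
      DivisorClass (SeparableClosure K) C.sepBaseChange.FunctionField :=
  (C.sepBaseChange.semilinearAut (σ : SeparableClosure K ≃+* SeparableClosure K)
    (C.sepBaseChange_map σ)).classMap

/-- The group of `K`-rational points of the Jacobian: the divisor classes of degree zero on the
curve over the separable closure of `K` that are fixed by the absolute Galois group of `K`. -/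
def jacobianPoints (C : SexticModel K) :
    AddSubgroup (DivisorClass (SeparableClosure K) C.sepBaseChange.FunctionField) where
  carrier := {c | c ∈ DivisorClass.degreeZero (SeparableClosure K) C.sepBaseChange.FunctionField ∧
    ∀ σ : SeparableClosure K ≃ₐ[K] SeparableClosure K, C.galoisAction σ c = c}
  add_mem' ha hb := ⟨add_mem ha.1 hb.1, fun σ => by rw [map_add, ha.2, hb.2]⟩
  zero_mem' := ⟨zero_mem _, fun σ => map_zero _⟩
  neg_mem' ha := ⟨neg_mem ha.1, fun σ => by rw [map_neg, ha.2]⟩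

end SexticModel

end

/-! ### Double covers of the line and the integral closure of `k[x]`. -/

noncomputable section

/-! The sextic is even in `x`, so the curve maps to two genus-one curves, and the family is arranged
so that one of them carries a point of order 8 and the other a point of order 3. The torsion point
is the sum of the two pullbacks.

With `e = -(28672/3) s`, `x² = e + d z` and `y = d w` the equation becomes `w² = z³ - 31 z² + 256
z`, independent of `s`. On this curve `(16, 16)` has order 4, and the line `w = 32 - z` is tangent
at `(8, 24)` and passes through `(16, 16)`, so `(8, 24)` has order 8. With `u = x⁻²` and `w = y /
x³` the equation becomes `d w² = c₀ u³ + c₂ u² + c₄ u + 1`, and the right-hand side can be written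
`d (m + n u)² + c₀ (u - t)³`: the line `w = m + n u` meets this curve triply at `u = t`, which gives
the point of order 3.

The proof works with divisors on the genus-two curve itself. The divisor of `y - m(x)` is read off
from its norm, since `d (y - m)(y + m) = f - d m²` (`ord_sub_aeval`). This exhibits 8 times one
divisor and 3 times the other as divisors of explicit functions (`exists_divisor_order_eight`,
`exists_divisor_order_three`). That the orders do not drop follows from a Riemann–Roch-type fact: a
function whose poles are at most double at each point at infinity is a polynomial in `x`
(`exists_eq_aeval`), hence invariant under `y ↦ -y`.

The points involved need square roots and live over the separable closure, but the functions have
coefficients in `K`. As a multiple of each divisor is the divisor of a Galois-invariant function and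
`ℤ` is torsion-free, the divisors themselves are Galois-invariant (`divisorMap_eq_self`).

The places needed come from primes of the integral closure of `k[x]`, which is `k[x] + k[x] y`
because `f` is squarefree. The same description, in the chart at infinity as well, shows that the
regular differentials are spanned by `dx / y` and `x dx / y`, so the genus is 2. -/

/-- The field `F` is the function field of `d y² = f(x)`, with `f` a separable sextic over `k`
not vanishing at `0`. -/
structure DoubleCover {k F : Type*} [Field k] [Field F] [Algebra k F] (d : k) (f : k[X])
    (x y : F) : Prop where
  two_ne : (2 : k) ≠ 0
  d_ne : d ≠ 0
  sep : IsCoprime f (derivative f)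
  natDegree_eq : f.natDegree = 6
  coeff_zero_ne : f.coeff 0 ≠ 0
  eqn : algebraMap k F d * y ^ 2 = aeval x f
  indep : ∀ a b : k[X], aeval x a + aeval x b * y = 0 → a = 0 ∧ b = 0
  repr : ∀ h : F, ∃ a b c : k[X], c ≠ 0 ∧ h * aeval x c = aeval x a + aeval x b * y

/-- `P` is centred on the affine curve with coordinates `x`, `y`, and its valuation ring is a
localization of the coordinate ring. -/
structure Place.IsLocalizedAt {k F : Type*} [Field k] [Field F] [Algebra k F] (P : Place k F)
    (x y : F) : Prop where
  val_le : P.val x ≤ 1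
  exists_den : ∀ g : F, P.val g ≤ 1 → ∃ a b a' b' : k[X],
    P.val (aeval x a' + aeval x b' * y) = 1 ∧
      g * (aeval x a' + aeval x b' * y) = aeval x a + aeval x b * y

/-- If `q` is the reduced denominator of `β`, then `q²` divides `f`, so squarefreeness makes `q` a
unit. -/
theorem exists_eq_algebraMap_of_sq_mul {R K : Type*} [CommRing R] [IsDomain R]
    [UniqueFactorizationMonoid R] [Field K] [Algebra R K] [IsFractionRing R K] {f : R}
    (hf : Squarefree f) {β : K} {r : R} (h : β ^ 2 * algebraMap R K f = algebraMap R K r) :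
    ∃ b, β = algebraMap R K b := by
  have hinj := IsFractionRing.injective R K
  set p := IsFractionRing.num R β
  set q := (IsFractionRing.den R β : R)
  have hpq : IsRelPrime p q := IsFractionRing.num_den_reduced R β
  have hq : q ≠ 0 := nonZeroDivisors.coe_ne_zero _
  have hq' : algebraMap R K q ≠ 0 := by simpa using (map_ne_zero_iff _ hinj).2 hq
  have hβ : β * algebraMap R K q = algebraMap R K p := by
    have := IsFractionRing.mk'_num_den' R β
    rw [← this, div_mul_cancel₀ _ hq']
  have h1 : p ^ 2 * f = q ^ 2 * r := by
    apply hinj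
    rw [map_mul, map_mul, map_pow, map_pow, ← h, ← hβ]
    ring
  have h2 : q ^ 2 ∣ f := by
    have : IsRelPrime (q ^ 2) (p ^ 2) := hpq.symm.pow
    exact this.dvd_of_dvd_mul_left ⟨r, h1⟩
  have hu : IsUnit q := hf q (by rwa [← sq])
  obtain ⟨u, hu⟩ := hu
  refine ⟨p * ↑u⁻¹, ?_⟩
  rw [map_mul, ← hβ, ← hu, mul_assoc, ← map_mul, Units.mul_inv, map_one, mul_one]

namespace DoubleCover

section Polynomials

variable {k F : Type*} [Field k] [Field F] [Algebra k F] {d : k} {f : k[X]} {x y : F}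

theorem aeval_injective (S : DoubleCover d f x y) :
    Function.Injective (aeval x : k[X] →ₐ[k] F) := by
  refine (injective_iff_map_eq_zero _).2 fun a ha => (S.indep a 0 ?_).1
  simp [ha]

theorem aeval_ne_zero (S : DoubleCover d f x y) {c : k[X]} (hc : c ≠ 0) : aeval x c ≠ 0 :=
  (map_ne_zero_iff _ S.aeval_injective).2 hc

theorem f_ne (S : DoubleCover d f x y) : f ≠ 0 := by
  rintro rfl
  simpa using S.natDegree_eq

theorem squarefree (S : DoubleCover d f x y) : Squarefree f :=
  Polynomial.Separable.squarefree S.sep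

end Polynomials

section FractionField

variable {k F : Type*} [Field k] [Field F] [Algebra k F] {d : k} {f : k[X]} {x y : F}
  [Algebra k[X] F]

theorem exists_fraction (S : DoubleCover d f x y) (Q : Type*) [Field Q] [Algebra k[X] Q]
    [IsFractionRing k[X] Q] [Algebra Q F] [IsScalarTower k[X] Q F]
    (hx : ∀ p : k[X], algebraMap k[X] F p = aeval x p) (h : F) :
    ∃ α β : Q, h = algebraMap Q F α + algebraMap Q F β * y := by
  obtain ⟨a, b, c, hc, e⟩ := S.repr h
  have hc' : aeval x c ≠ 0 := S.aeval_ne_zero hc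
  refine ⟨algebraMap _ Q a / algebraMap _ Q c, algebraMap _ Q b / algebraMap _ Q c, ?_⟩
  simp only [map_div₀, ← IsScalarTower.algebraMap_apply, hx]
  field_simp
  rw [e]

theorem finiteDimensional (S : DoubleCover d f x y) (Q : Type*) [Field Q] [Algebra k[X] Q]
    [IsFractionRing k[X] Q] [Algebra Q F] [IsScalarTower k[X] Q F]
    (hx : ∀ p : k[X], algebraMap k[X] F p = aeval x p) : FiniteDimensional Q F := by
  refine ⟨Submodule.fg_def.2 ⟨({1, y} : Set F), by simp, ?_⟩⟩
  rw [eq_top_iff]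
  rintro h -
  obtain ⟨α, β, rfl⟩ := S.exists_fraction Q hx h
  refine add_mem ?_ ?_
  · rw [Algebra.algebraMap_eq_smul_one]
    exact Submodule.smul_mem _ _ (Submodule.subset_span (by simp))
  · rw [← Algebra.smul_def]
    exact Submodule.smul_mem _ _ (Submodule.subset_span (by simp))

theorem eqn_fraction (S : DoubleCover d f x y) (Q : Type*) [Field Q] [Algebra k[X] Q]
    [Algebra Q F] [IsScalarTower k[X] Q F]
    (hx : ∀ p : k[X], algebraMap k[X] F p = aeval x p) :
    y ^ 2 = algebraMap Q F (algebraMap k[X] Q (C d⁻¹ * f)) := by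
  have hd : algebraMap k F d ≠ 0 := by simpa using S.d_ne
  rw [← IsScalarTower.algebraMap_apply, hx, map_mul, aeval_C, map_inv₀, ← S.eqn]
  field_simp

theorem isSeparable (S : DoubleCover d f x y) (Q : Type*) [Field Q] [Algebra k[X] Q]
    [IsFractionRing k[X] Q] [Algebra Q F] [IsScalarTower k[X] Q F]
    (hx : ∀ p : k[X], algebraMap k[X] F p = aeval x p) : Algebra.IsSeparable Q F := by
  have hinj : Function.Injective (algebraMap k[X] Q) := IsFractionRing.injective _ _
  have hy : IsSeparable Q y := by
    have h0 : algebraMap k[X] Q (C d⁻¹ * f) ≠ 0 :=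
      (map_ne_zero_iff _ hinj).2 (mul_ne_zero (by simpa using S.d_ne) S.f_ne)
    have h2 : ((2 : ℕ) : Q) ≠ 0 := by
      have := (map_ne_zero_iff ((algebraMap k[X] Q).comp C)
        (hinj.comp C_injective)).2 S.two_ne
      rwa [map_ofNat] at this
    refine (separable_X_pow_sub_C _ h2 h0).of_dvd (minpoly.dvd _ _ ?_)
    simp only [map_sub, map_pow, aeval_X, aeval_C]
    rw [S.eqn_fraction Q hx, sub_self]
  have htop : IntermediateField.adjoin Q {y} = ⊤ := by
    rw [eq_top_iff]
    rintro h -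
    obtain ⟨α, β, rfl⟩ := S.exists_fraction Q hx h
    exact add_mem (IntermediateField.algebraMap_mem _ _) (mul_mem
      (IntermediateField.algebraMap_mem _ _) (IntermediateField.mem_adjoin_simple_self Q y))
  have := (IntermediateField.isSeparable_adjoin_simple_iff_isSeparable Q F).2 hy
  rw [htop] at this
  exact AlgEquiv.Algebra.isSeparable IntermediateField.topEquiv

/-- For `h = α + β y` with `β ≠ 0` the minimal polynomial has coefficients `-2α` and `α² - β² f /
d`, which must be polynomials since `k[x]` is integrally closed. As 2 is invertible, `α` is a
polynomial; then so is `β² f / d`, and squarefreeness of `f` makes `β` a polynomial. -/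
theorem exists_of_isIntegral (S : DoubleCover d f x y) (Q : Type*) [Field Q] [Algebra k[X] Q]
    [IsFractionRing k[X] Q] [Algebra Q F] [IsScalarTower k[X] Q F]
    (hx : ∀ p : k[X], algebraMap k[X] F p = aeval x p) {h : F} (hh : IsIntegral k[X] h) :
    ∃ a b : k[X], h = aeval x a + aeval x b * y := by
  have hinj : Function.Injective (algebraMap k[X] Q) := IsFractionRing.injective _ _
  have hint : ∀ α : Q, IsIntegral k[X] α → ∃ a, algebraMap k[X] Q a = α := fun α =>
    IsIntegrallyClosed.isIntegral_iff.1
  obtain ⟨α, β, rfl⟩ := S.exists_fraction Q hx h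
  by_cases hβ : β = 0
  · subst hβ
    simp only [map_zero, zero_mul, add_zero] at hh ⊢
    obtain ⟨a, rfl⟩ := hint α ((isIntegral_algebraMap_iff (algebraMap Q F).injective).1 hh)
    exact ⟨a, 0, by simp [← IsScalarTower.algebraMap_apply, hx]⟩
  set h := algebraMap Q F α + algebraMap Q F β * y with hdef
  obtain ⟨δ, hδ⟩ : ∃ δ, δ = α ^ 2 - β ^ 2 * algebraMap k[X] Q (C d⁻¹ * f) := ⟨_, rfl⟩
  set q : Q[X] := X ^ 2 + C (-2 * α) * X
    + C δ with hq
  have hroot : aeval h q = 0 := by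
    have e := S.eqn_fraction Q hx
    rw [hq, hδ]
    generalize algebraMap k[X] Q (C d⁻¹ * f) = φ at e ⊢
    simp only [map_add, map_pow, map_mul, aeval_X, aeval_C, map_sub, map_neg, map_ofNat, hdef]
    linear_combination algebraMap Q F β ^ 2 * e
  have hqm : q.Monic := by rw [hq]; monicity!
  have hqd : q.natDegree = 2 := by rw [hq]; compute_degree!
  have hI : IsIntegral Q h := ⟨q, hqm, hroot⟩
  have hnot : h ∉ (algebraMap Q F).range := by
    rintro ⟨γ, hγ⟩
    have : y = algebraMap Q F ((γ - α) / β) := by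
      have : algebraMap Q F β ≠ 0 := by simpa using hβ
      rw [map_div₀, map_sub, hγ, hdef]
      field_simp
      ring
    obtain ⟨a, b, hb, e⟩ := IsFractionRing.div_surjective (A := k[X]) ((γ - α) / β)
    rw [← e, map_div₀, ← IsScalarTower.algebraMap_apply, ← IsScalarTower.algebraMap_apply,
      hx, hx] at this
    have hb' := S.aeval_ne_zero (nonZeroDivisors.ne_zero hb)
    refine nonZeroDivisors.ne_zero hb (S.indep (-a) b ?_).2
    rw [this]
    field_simp
    simp
  have hmin : minpoly Q h = q := by
    refine (eq_of_monic_of_dvd_of_natDegree_le (minpoly.monic hI) hqm (minpoly.dvd _ _ hroot)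
      ?_).symm
    rw [hqd]
    exact (minpoly.two_le_natDegree_iff hI).2 hnot
  have hmin' := minpoly.isIntegrallyClosed_eq_field_fractions' Q hh
  rw [hmin] at hmin'
  have hc1 : -2 * α = algebraMap k[X] Q ((minpoly k[X] h).coeff 1) := by
    have := congrArg (coeff · 1) hmin'
    simpa [hq, coeff_X, coeff_C] using this
  have hc0 : δ = algebraMap k[X] Q ((minpoly k[X] h).coeff 0) := by
    have := congrArg (coeff · 0) hmin'
    simpa [hq, coeff_X, coeff_C] using this
  have h2 : algebraMap k[X] Q (C (2 : k)) ≠ 0 :=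
    (map_ne_zero_iff _ hinj).2 (by simpa using S.two_ne)
  have h22 : algebraMap k[X] Q (C (2 : k)) = 2 := by rw [map_ofNat, map_ofNat]
  obtain ⟨a, ha⟩ : ∃ a, α = algebraMap k[X] Q a := by
    refine ⟨-(C (2⁻¹ : k)) * (minpoly k[X] h).coeff 1, ?_⟩
    rw [map_mul, ← hc1, map_neg]
    have : algebraMap k[X] Q (C (2⁻¹ : k)) * 2 = 1 := by
      rw [← h22, ← map_mul, ← C_mul, inv_mul_cancel₀ S.two_ne, C_1, map_one]
    linear_combination (-α) * this
  have hfd : Squarefree (C d⁻¹ * f) := by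
    refine (Associated.squarefree_iff ?_).1 S.squarefree
    refine ⟨(Polynomial.isUnit_C.2 (IsUnit.mk0 d⁻¹ (inv_ne_zero S.d_ne))).unit, ?_⟩
    simp [mul_comm]
  obtain ⟨b, hb⟩ := exists_eq_algebraMap_of_sq_mul (K := Q) hfd
    (β := β) (r := a ^ 2 - (minpoly k[X] h).coeff 0) (by
      rw [map_sub, ← hc0, hδ, ha, map_pow]; ring)
  refine ⟨a, b, ?_⟩
  rw [hdef, ha, hb, ← IsScalarTower.algebraMap_apply, ← IsScalarTower.algebraMap_apply, hx, hx]

end FractionField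
end DoubleCover
end

/-! ### Places from primes, the chart at infinity, and functions with bounded poles. -/

noncomputable section

open IsDedekindDomain

/-- The place of a fraction field attached to a height one prime of a Dedekind domain. -/
def IsDedekindDomain.HeightOneSpectrum.toPlace {k B F : Type*} [Field k] [CommRing B]
    [IsDedekindDomain B] [Field F] [Algebra k B] [Algebra k F] [Algebra B F] [IsFractionRing B F]
    [IsScalarTower k B F] (v : HeightOneSpectrum B) : Place k F where
  val := v.valuation F
  surj := v.valuation_surjective F
  map_const c hc := by
    rw [IsScalarTower.algebraMap_apply k B F, HeightOneSpectrum.valuation_eq_one_iff_notMem]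
    exact fun h => v.isPrime.ne_top
      (Ideal.eq_top_of_isUnit_mem _ h ((IsUnit.mk0 c hc).map (algebraMap k B)))

namespace DoubleCover

variable {k F : Type*} [Field k] [Field F] [Algebra k F] {d : k} {f : k[X]} {x y : F}

theorem faithfulSMul [Algebra k[X] F] (S : DoubleCover d f x y)
    (hx : ∀ p : k[X], algebraMap k[X] F p = aeval x p) : FaithfulSMul k[X] F :=
  (faithfulSMul_iff_algebraMap_injective _ _).2 fun a b h => by
    rw [hx, hx] at h
    exact S.aeval_injective h

/-- The integral closure of `k[x]` in `F` is a Dedekind domain, so an element outside it has a pole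
at some prime. This is the only source of places in the proof, and such places have localizations of
the coordinate ring as valuation rings. -/
theorem exists_place (S : DoubleCover d f x y) {h : F}
    (hh : ¬ ∃ a b : k[X], h = aeval x a + aeval x b * y) :
    ∃ P : Place k F, P.IsLocalizedAt x y ∧ 1 < P.val h := by
  let : Algebra k[X] F := (aeval x : k[X] →ₐ[k] F).toRingHom.toAlgebra
  have hx : ∀ p : k[X], algebraMap k[X] F p = aeval x p := fun _ => rfl
  have : IsScalarTower k k[X] F := IsScalarTower.of_algebraMap_eq fun c => by simp [hx]
  have := S.faithfulSMul hx
  let : Algebra (FractionRing k[X]) F := FractionRing.liftAlgebra k[X] F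
  have : IsScalarTower k[X] (FractionRing k[X]) F := FractionRing.isScalarTower_liftAlgebra _ _
  have := S.finiteDimensional (FractionRing k[X]) hx
  have := S.isSeparable (FractionRing k[X]) hx
  have : IsDedekindDomain (integralClosure k[X] F) := inferInstance
  have : IsFractionRing (integralClosure k[X] F) F :=
    integralClosure.isFractionRing_of_finite_extension (FractionRing k[X]) F
  have hB : ∀ b : integralClosure k[X] F, ∃ p q : k[X], (b : F) = aeval x p + aeval x q * y :=
    fun b => S.exists_of_isIntegral (FractionRing k[X]) hx b.2
  have hh' : h ∉ (algebraMap (integralClosure k[X] F) F).range := by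
    rintro ⟨b, rfl⟩
    exact hh (hB b)
  have : ∃ v : HeightOneSpectrum (integralClosure k[X] F), 1 < v.valuation F h := by
    by_contra! hv
    exact hh' (HeightOneSpectrum.mem_integers_of_valuation_le_one F h hv)
  obtain ⟨v, hv⟩ := this
  refine ⟨v.toPlace, ⟨?_, fun g hg => ?_⟩, hv⟩
  · have : x = algebraMap (integralClosure k[X] F) F (algebraMap k[X] _ X) := by
      rw [← IsScalarTower.algebraMap_apply, hx, aeval_X]
    conv_lhs => rw [this]
    exact v.valuation_le_one _
  · obtain ⟨n, ⟨q, hq⟩, e⟩ := HeightOneSpectrum.exists_primeCompl_mul_eq_of_integer v g hg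
    obtain ⟨a, b, hn⟩ := hB n
    obtain ⟨a', b', hq'⟩ := hB q
    refine ⟨a, b, a', b', ?_, ?_⟩
    · rw [← hq']
      exact (v.valuation_eq_one_iff_notMem (K := F)).2 hq
    · rw [← hn, ← hq']
      exact e

theorem x_ne (S : DoubleCover d f x y) : x ≠ 0 := by
  simpa using S.aeval_ne_zero (X_ne_zero (R := k))

theorem aeval_inv_reflect {p : k[X]} {x : F} (hx : x ≠ 0) {N : ℕ} (hN : p.natDegree ≤ N) :
    aeval x⁻¹ (p.reflect N) * x ^ N = aeval x p := by
  have : Invertible x := invertibleOfNonzero hx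
  have := eval₂_reflect_mul_pow (algebraMap k F) x N p hN
  rwa [invOf_eq_inv] at this

theorem aeval_reflect {p : k[X]} {x : F} (hx : x ≠ 0) {N : ℕ} (hN : p.natDegree ≤ N) :
    aeval x (p.reflect N) = aeval x⁻¹ p * x ^ N := by
  rw [← aeval_inv_reflect (inv_ne_zero hx) hN, inv_inv, mul_assoc, ← mul_pow,
    inv_mul_cancel₀ hx, one_pow, mul_one]

/-- The Euler operator `X d/dX` multiplies the coefficient of `X ^ n` by `n`, and reflection
exchanges `n` with `N - n`. -/
theorem X_mul_derivative_reflect {p : k[X]} {N : ℕ} (hN : p.natDegree ≤ N) :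
    X * derivative (p.reflect N) = C (N : k) * p.reflect N - (X * derivative p).reflect N := by
  have key : ∀ (q : k[X]) (n : ℕ), (X * derivative q).coeff n = n * q.coeff n := by
    intro q n
    rcases n with _ | n
    · simp
    · rw [coeff_X_mul, coeff_derivative]; push_cast; ring
  ext n
  rw [key, coeff_sub, coeff_C_mul, coeff_reflect, coeff_reflect, key]
  rcases le_or_gt n N with h | h
  · rw [revAt_le h, Nat.cast_sub h]; ring
  · rw [revAt_eq_self_of_lt h, coeff_eq_zero_of_natDegree_lt (hN.trans_lt h)]; ring

theorem coeff_zero_reflect (p : k[X]) : (p.reflect p.natDegree).coeff 0 = p.leadingCoeff := by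
  rw [coeff_reflect, revAt_zero, leadingCoeff]

/-- A multiple root `z` of the reflected polynomial would give the multiple root `z⁻¹` of `p`; `z =
0` is excluded because the constant term is the leading coefficient of `p`. -/
theorem isCoprime_reflect {p : k[X]} (hp : IsCoprime p (derivative p)) {N : ℕ}
    (hN : p.natDegree = N) : IsCoprime (p.reflect N) (derivative (p.reflect N)) := by
  have hp0 : p ≠ 0 := by
    rintro rfl
    exact not_isUnit_zero (isCoprime_self.1 (by simpa using hp))
  rw [isCoprime_iff_aeval_ne_zero_of_isAlgClosed k (AlgebraicClosure k)] at hp ⊢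
  intro z
  by_contra! h
  obtain ⟨h1, h2⟩ := h
  have hz : z ≠ 0 := by
    rintro rfl
    rw [aeval_def, eval₂_at_zero, ← hN, coeff_zero_reflect] at h1
    exact hp0 (by simpa using h1)
  have hX : (X * derivative p).natDegree ≤ N := by
    rcases Nat.eq_zero_or_pos p.natDegree with h0 | h0
    · rw [derivative_of_natDegree_zero h0]; simp
    · refine natDegree_mul_le.trans ?_
      have := natDegree_derivative_lt h0.ne'
      rw [natDegree_X]
      omega
  have e := congrArg (aeval z) (X_mul_derivative_reflect hN.le)
  rw [map_sub, map_mul, map_mul, h1, h2, aeval_reflect hz hX] at e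
  rw [aeval_reflect hz hN.le] at h1
  have hzN : z ^ N ≠ 0 := pow_ne_zero _ hz
  rcases hp z⁻¹ with h3 | h3
  · exact h3 ((mul_eq_zero.1 h1).resolve_right hzN)
  · apply h3
    simpa [hz] using e

/-- This symmetry transfers every statement about the affine chart to the chart at infinity. The
nonvanishing of `f` at 0 is what keeps the degree equal to 6. -/
theorem swap (S : DoubleCover d f x y) : DoubleCover d (f.reflect 6) x⁻¹ (y / x ^ 3) where
  two_ne := S.two_ne
  d_ne := S.d_ne
  sep := isCoprime_reflect S.sep S.natDegree_eq
  natDegree_eq := by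
    refine le_antisymm ?_ (le_natDegree_of_ne_zero ?_)
    · exact (natDegree_reflect_le).trans (by simp [S.natDegree_eq])
    · rw [coeff_reflect, revAt_le le_rfl]
      simpa using S.coeff_zero_ne
  coeff_zero_ne := by
    rw [← S.natDegree_eq, coeff_zero_reflect]
    simpa using S.f_ne
  eqn := by
    have hx := S.x_ne
    have := aeval_inv_reflect hx S.natDegree_eq.le
    rw [← S.eqn] at this
    generalize aeval x⁻¹ (f.reflect 6) = r at this ⊢
    field_simp
    rw [← this]
    ring
  indep := by
    intro a b h
    have hx := S.x_ne
    set N := max a.natDegree b.natDegree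
    have ha : aeval x (a.reflect N) = _ := aeval_reflect hx (le_max_left _ _)
    have hb : aeval x (b.reflect N) = _ := aeval_reflect hx (le_max_right _ _)
    have := S.indep (a.reflect N * X ^ 3) (b.reflect N) (by
      rw [map_mul, ha, hb, map_pow, aeval_X]
      have : aeval x⁻¹ a * x ^ 3 + aeval x⁻¹ b * y = 0 := by
        generalize aeval x⁻¹ a = α, aeval x⁻¹ b = β at h ⊢
        field_simp at h
        linear_combination h
      linear_combination x ^ N * this)
    simpa using this
  repr := by
    intro h
    have hx := S.x_ne
    obtain ⟨a, b, c, hc, e⟩ := S.repr h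
    set N := max a.natDegree (max b.natDegree c.natDegree)
    have ha : a.natDegree ≤ N := le_max_left _ _
    have hb : b.natDegree ≤ N := (le_max_left _ _).trans (le_max_right _ _)
    have hc' : c.natDegree ≤ N := (le_max_right _ _).trans (le_max_right _ _)
    refine ⟨a.reflect N * X ^ 3, b.reflect N, c.reflect N * X ^ 3, ?_, ?_⟩
    · exact mul_ne_zero (by simpa using hc) (pow_ne_zero _ X_ne_zero)
    · rw [← aeval_inv_reflect hx ha, ← aeval_inv_reflect hx hb, ← aeval_inv_reflect hx hc'] at e
      have hN : x ^ N ≠ 0 := pow_ne_zero _ hx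
      simp only [map_mul, map_pow, aeval_X]
      have e' : h * aeval x⁻¹ (c.reflect N) =
          aeval x⁻¹ (a.reflect N) + aeval x⁻¹ (b.reflect N) * y := by
        apply mul_right_cancel₀ hN
        linear_combination e
      generalize aeval x⁻¹ (a.reflect N) = α, aeval x⁻¹ (b.reflect N) = β,
        aeval x⁻¹ (c.reflect N) = γ at e' ⊢
      field_simp
      linear_combination e'

/-- A function with poles at most of order `n ≤ 2` at infinity is a polynomial in `x` of degree
at most `n`. -/
theorem exists_eq_aeval (S : DoubleCover d f x y) {h : F} {n : ℕ} (hn : n ≤ 2)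
    (hfin : ∀ P : Place k F, P.IsLocalizedAt x y → P.val h ≤ 1)
    (hinf : ∀ P : Place k F, P.IsLocalizedAt x⁻¹ (y / x ^ 3) → P.val (h * x⁻¹ ^ n) ≤ 1) :
    ∃ a : k[X], a.natDegree ≤ n ∧ h = aeval x a := by
  have hx := S.x_ne
  have h1 : ∃ a b : k[X], h = aeval x a + aeval x b * y := by
    by_contra H
    obtain ⟨P, hP, hv⟩ := S.exists_place H
    exact absurd (hfin P hP) (not_le.2 hv)
  have h2 : ∃ a b : k[X], h * x⁻¹ ^ n = aeval x⁻¹ a + aeval x⁻¹ b * (y / x ^ 3) := by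
    by_contra H
    obtain ⟨P, hP, hv⟩ := S.swap.exists_place H
    exact absurd (hinf P hP) (not_le.2 hv)
  obtain ⟨a, b, rfl⟩ := h1
  obtain ⟨α, β, e⟩ := h2
  set N := max α.natDegree β.natDegree
  have hα : aeval x (α.reflect N) = _ := aeval_reflect hx (le_max_left _ _)
  have hβ : aeval x (β.reflect N) = _ := aeval_reflect hx (le_max_right _ _)
  have key := S.indep (a * X ^ (N + 3 - n) - α.reflect N * X ^ 3)
    (b * X ^ (N + 3 - n) - β.reflect N) (by
      simp only [map_sub, map_mul, map_pow, aeval_X, hα, hβ]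
      have e1 : x ^ (N + 3) = x ^ (N + 3 - n) * x ^ n := by
        rw [← pow_add]; congr 1; omega
      have hxn : x ^ n ≠ 0 := pow_ne_zero _ hx
      have e2 : (aeval x a + aeval x b * y) * x ^ 3 =
          (aeval x⁻¹ α * x ^ 3 + aeval x⁻¹ β * y) * x ^ n := by
        generalize aeval x⁻¹ α = α', aeval x⁻¹ β = β' at e ⊢
        rw [inv_pow] at e
        field_simp at e
        linear_combination e
      apply mul_right_cancel₀ hxn
      rw [pow_add] at e1
      linear_combination x ^ N * e2 - (aeval x a + aeval x b * y) * e1)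
  obtain ⟨k1, k2⟩ := key
  rw [sub_eq_zero] at k1 k2
  have hdeg : ∀ p : k[X], p.natDegree ≤ N → (p.reflect N).natDegree ≤ N := fun p hp =>
    natDegree_reflect_le.trans (by simp [hp])
  -- Here `n ≤ 2` enters: `y` has a pole of order 3 at infinity. In degrees, `b X ^ (N + 3 - n)`
  -- would have degree greater than `N`, the bound for the right-hand side of `k2`.
  have hb : b = 0 := by
    by_contra hb
    have := congrArg natDegree k2
    rw [natDegree_mul_X_pow _ hb] at this
    have h3 := hdeg β (le_max_right _ _)
    omega
  refine ⟨a, ?_, by simp [hb]⟩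
  by_cases ha : a = 0
  · simp [ha]
  have := congrArg natDegree k1
  rw [natDegree_mul_X_pow _ ha] at this
  have h3 := hdeg α (le_max_left _ _)
  have h4 := (natDegree_mul_le (p := α.reflect N) (q := X ^ 3))
  rw [natDegree_X_pow] at h4
  omega

end DoubleCover
end

/-! ### Regular differentials and the genus. -/

noncomputable section

open KaehlerDifferential

namespace Place

variable {k F : Type*} [Field k] [Field F] [Algebra k F]

/-- The differentials regular at a place. -/
abbrev regularAt (P : Place k F) : Submodule k (Ω[F⁄k]) :=
  Submodule.span k {ω | ∃ g ∈ P.integers, ∃ f ∈ P.integers, ω = g • D k F f}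

theorem smul_mem_regularAt (P : Place k F) {g : F} (hg : P.val g ≤ 1) {ω : Ω[F⁄k]}
    (hω : ω ∈ P.regularAt) : g • ω ∈ P.regularAt := by
  induction hω using Submodule.span_induction with
  | mem ω h =>
    obtain ⟨g', hg', f, hf, rfl⟩ := h
    refine Submodule.subset_span ⟨g * g', ?_, f, hf, by rw [mul_smul]⟩
    change P.val (g * g') ≤ 1
    rw [map_mul]
    exact mul_le_one' hg hg'
  | zero => rw [smul_zero]; exact zero_mem _
  | add a b _ _ ha hb => rw [smul_add]; exact add_mem ha hb
  | smul c a _ ha => rw [smul_comm]; exact Submodule.smul_mem _ _ ha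

theorem D_mem_regularAt (P : Place k F) {f : F} (hf : P.val f ≤ 1) : D k F f ∈ P.regularAt :=
  Submodule.subset_span ⟨1, by change P.val 1 ≤ 1; simp, f, hf, by simp⟩

theorem val_algebraMap_le (P : Place k F) (c : k) : P.val (algebraMap k F c) ≤ 1 := by
  by_cases hc : c = 0
  · simp [hc]
  · exact (P.map_const c hc).le

theorem val_aeval_le (P : Place k F) {x : F} (hx : P.val x ≤ 1) (p : k[X]) :
    P.val (aeval x p) ≤ 1 := by
  have : aeval x p ∈ P.val.integer.toSubsemiring := by
    induction p using Polynomial.induction_on' with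
    | add p q hp hq => rw [map_add]; exact add_mem hp hq
    | monomial n c =>
      rw [aeval_monomial]
      refine mul_mem (P.val_algebraMap_le c) (pow_mem hx n)
  exact this

end Place

namespace DoubleCover

variable {k F : Type*} [Field k] [Field F] [Algebra k F] {d : k} {f : k[X]} {x y : F}

/-- Since `F` is separable over `k(x)`, it is formally étale over `k[x]`, so its differentials are
obtained from those of `k[x]` by extension of scalars, with basis `dx`. -/
theorem exists_kaehlerEquiv (S : DoubleCover d f x y) :
    ∃ e : Ω[F⁄k] ≃ₗ[F] F, e (D k F x) = 1 := by
  let : Algebra k[X] F := (aeval x : k[X] →ₐ[k] F).toRingHom.toAlgebra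
  have hx : ∀ p : k[X], algebraMap k[X] F p = aeval x p := fun _ => rfl
  have : IsScalarTower k k[X] F := IsScalarTower.of_algebraMap_eq fun c => by simp [hx]
  have := S.faithfulSMul hx
  let : Algebra (FractionRing k[X]) F := FractionRing.liftAlgebra k[X] F
  have : IsScalarTower k[X] (FractionRing k[X]) F := FractionRing.isScalarTower_liftAlgebra _ _
  have := S.isSeparable (FractionRing k[X]) hx
  have : Algebra.FormallyEtale (FractionRing k[X]) F := Algebra.FormallyEtale.of_isSeparable _ _
  have : Algebra.FormallyEtale k[X] (FractionRing k[X]) :=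
    Algebra.FormallyEtale.of_isLocalization (nonZeroDivisors k[X])
  have : Algebra.FormallyEtale k[X] F := Algebra.FormallyEtale.comp k[X] (FractionRing k[X]) F
  refine ⟨(tensorKaehlerEquivOfFormallyEtale k k[X] F).symm ≪≫ₗ
    ((polynomialEquiv k).baseChange k[X] F _ _) ≪≫ₗ
    TensorProduct.AlgebraTensorModule.rid k[X] F F, ?_⟩
  have hX : x = algebraMap k[X] F X := by rw [hx, aeval_X]
  rw [hX, LinearEquiv.trans_apply, LinearEquiv.trans_apply,
    tensorKaehlerEquivOfFormallyEtale_symm_D_algebraMap]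
  simp

theorem y_ne (S : DoubleCover d f x y) : y ≠ 0 := by
  rintro rfl
  exact one_ne_zero (S.indep 0 1 (by simp)).2

theorem two_ne' (S : DoubleCover d f x y) : (2 : F) ≠ 0 := by
  have := (map_ne_zero (algebraMap k F)).2 S.two_ne
  rwa [map_ofNat] at this

theorem d_ne' (S : DoubleCover d f x y) : algebraMap k F d ≠ 0 :=
  (map_ne_zero (algebraMap k F)).2 S.d_ne

/-- The differential `dx / y`. -/
def _root_.invariantDifferential (k : Type*) {F : Type*} [Field k] [Field F] [Algebra k F]
    (x y : F) : Ω[F⁄k] := y⁻¹ • D k F x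

theorem exists_eq_smul (S : DoubleCover d f x y) (ω : Ω[F⁄k]) :
    ∃ h : F, ω = h • invariantDifferential k x y := by
  obtain ⟨e, he⟩ := S.exists_kaehlerEquiv
  refine ⟨e ω * y, e.injective ?_⟩
  rw [invariantDifferential, smul_smul, mul_assoc, mul_inv_cancel₀ S.y_ne, mul_one, map_smul, he]
  simp

theorem invariantDifferential_ne (S : DoubleCover d f x y) :
    invariantDifferential k x y ≠ 0 := by
  obtain ⟨e, he⟩ := S.exists_kaehlerEquiv
  refine smul_ne_zero (inv_ne_zero S.y_ne) fun h => ?_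
  rw [h, map_zero] at he
  exact zero_ne_one he

theorem D_x (S : DoubleCover d f x y) : D k F x = y • invariantDifferential k x y := by
  rw [invariantDifferential, smul_smul, mul_inv_cancel₀ S.y_ne, one_smul]

theorem D_y (S : DoubleCover d f x y) :
    (2 * algebraMap k F d) • D k F y
      = aeval x (derivative f) • invariantDifferential k x y := by
  have h := congrArg (D k F) S.eqn
  rw [Derivation.map_aeval, Derivation.leibniz, Derivation.map_algebraMap, smul_zero, add_zero,
    Derivation.leibniz_pow, S.D_x] at h
  have h' := congrArg (y⁻¹ • ·) h
  have hy := S.y_ne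
  simp only [← Nat.cast_smul_eq_nsmul F, smul_smul] at h'
  convert h' using 2 <;> (push_cast; field_simp)

theorem val_y_le (S : DoubleCover d f x y) {P : Place k F} (hx : P.val x ≤ 1) : P.val y ≤ 1 := by
  have h := P.val_aeval_le hx f
  rw [← S.eqn, map_mul, P.map_const d S.d_ne, one_mul, map_pow] at h
  exact (pow_le_one_iff two_ne_zero).1 h

/-- From `u f + v f' = 1`, `f = d y²` and `f' dx / y = 2 d dy` one gets `dx / y = u d y dx + 2 d v
dy`, which has no denominator left. -/
theorem invariantDifferential_mem (S : DoubleCover d f x y) {P : Place k F} (hx : P.val x ≤ 1) :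
    invariantDifferential k x y ∈ P.regularAt := by
  obtain ⟨u, v, huv⟩ := S.sep
  have h1 : invariantDifferential k x y = (aeval x u * algebraMap k F d * y) • D k F x
      + (aeval x v * (2 * algebraMap k F d)) • D k F y := by
    rw [mul_smul (aeval x v), S.D_y, S.D_x, smul_smul, smul_smul, ← add_smul]
    have h2 := congrArg (aeval x) huv
    rw [map_add, map_mul, map_mul, map_one, ← S.eqn] at h2
    conv_lhs => rw [← one_smul F (invariantDifferential k x y), ← h2]
    congr 1
    ring
  have h2 : P.val (2 : F) ≤ 1 := by
    have := P.val_algebraMap_le 2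
    rwa [map_ofNat] at this
  rw [h1]
  refine add_mem (P.smul_mem_regularAt ?_ (P.D_mem_regularAt hx))
    (P.smul_mem_regularAt ?_ (P.D_mem_regularAt (S.val_y_le hx)))
  · rw [map_mul, map_mul]
    exact mul_le_one' (mul_le_one' (P.val_aeval_le hx _) (P.val_algebraMap_le d)) (S.val_y_le hx)
  · rw [map_mul, map_mul]
    exact mul_le_one' (P.val_aeval_le hx _) (mul_le_one' h2 (P.val_algebraMap_le d))

/-- Both `dx` and `dy` are integral multiples of `dx / y`, hence so is the differential of any
polynomial in `x` and `y`. The quotient rule extends this to the whole valuation ring, whose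
elements are fractions with unit denominator. -/
theorem exists_smul_of_mem (S : DoubleCover d f x y) {P : Place k F} (hP : P.IsLocalizedAt x y)
    {ω : Ω[F⁄k]} (hω : ω ∈ P.regularAt) :
    ∃ h : F, P.val h ≤ 1 ∧ ω = h • invariantDifferential k x y := by
  have hx := hP.val_le
  have hy := S.val_y_le hx
  have hDy : ∃ h : F, P.val h ≤ 1 ∧ D k F y = h • invariantDifferential k x y := by
    refine ⟨aeval x (derivative f) * (2 * algebraMap k F d)⁻¹, ?_, ?_⟩
    · have : P.val (2 * algebraMap k F d) = 1 := by
        have := P.map_const (2 * d) (mul_ne_zero S.two_ne S.d_ne)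
        simpa only [map_mul, map_ofNat] using this
      rw [map_mul, map_inv₀, this, inv_one, mul_one]
      exact P.val_aeval_le hx _
    · rw [mul_comm, mul_smul, ← S.D_y, smul_smul,
        inv_mul_cancel₀ (mul_ne_zero S.two_ne' S.d_ne'), one_smul]
  obtain ⟨η, hη, hDy⟩ := hDy
  have hA : ∀ a b : k[X], ∃ h : F, P.val h ≤ 1 ∧
      D k F (aeval x a + aeval x b * y) = h • invariantDifferential k x y := by
    intro a b
    refine ⟨aeval x (derivative a) * y + aeval x b * η + y * (aeval x (derivative b) * y), ?_, ?_⟩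
    · refine (P.val.map_add_le (P.val.map_add_le ?_ ?_) ?_)
      · rw [map_mul]; exact mul_le_one' (P.val_aeval_le hx _) hy
      · rw [map_mul]; exact mul_le_one' (P.val_aeval_le hx _) hη
      · rw [map_mul, map_mul]; exact mul_le_one' hy (mul_le_one' (P.val_aeval_le hx _) hy)
    · rw [map_add, Derivation.leibniz, Derivation.map_aeval, Derivation.map_aeval, hDy, S.D_x]
      simp only [smul_smul, ← add_smul, add_assoc]
  induction hω using Submodule.span_induction with
  | mem ω h =>
    obtain ⟨g, hg, φ, hφ, rfl⟩ := h
    obtain ⟨a, b, a', b', hq, e⟩ := hP.exists_den φ hφ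
    obtain ⟨u, hu, hu'⟩ := hA a b
    obtain ⟨v, hv, hv'⟩ := hA a' b'
    set q := aeval x a' + aeval x b' * y
    have hq0 : q ≠ 0 := by
      intro h0
      rw [h0, map_zero] at hq
      exact zero_ne_one hq
    rw [← e, Derivation.leibniz, hv', smul_smul, ← eq_sub_iff_add_eq', ← sub_smul] at hu'
    refine ⟨g * (q⁻¹ * (u - φ * v)), ?_, ?_⟩
    · rw [map_mul, map_mul, map_inv₀, hq, inv_one, one_mul]
      refine mul_le_one' hg (P.val.map_sub_le hu ?_)
      rw [map_mul]
      exact mul_le_one' hφ hv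
    · rw [mul_smul, mul_smul, ← hu', smul_smul q⁻¹, inv_mul_cancel₀ hq0, one_smul]
  | zero => exact ⟨0, by simp, by simp⟩
  | add a b _ _ ha hb =>
    obtain ⟨u, hu, rfl⟩ := ha
    obtain ⟨v, hv, rfl⟩ := hb
    exact ⟨u + v, P.val.map_add_le hu hv, by rw [add_smul]⟩
  | smul c a _ ha =>
    obtain ⟨u, hu, rfl⟩ := ha
    exact ⟨c • u, (P.val_smul_le c u).trans hu, by rw [smul_assoc]⟩

theorem val_le_of_mem (S : DoubleCover d f x y) {P : Place k F} (hP : P.IsLocalizedAt x y)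
    {h : F} (hω : h • invariantDifferential k x y ∈ P.regularAt) : P.val h ≤ 1 := by
  obtain ⟨u, hu, e⟩ := S.exists_smul_of_mem hP hω
  rwa [smul_left_injective F S.invariantDifferential_ne e]

theorem invariantDifferential_swap (S : DoubleCover d f x y) :
    invariantDifferential k x⁻¹ (y / x ^ 3) = -(x • invariantDifferential k x y) := by
  have hx := S.x_ne
  have hy := S.y_ne
  rw [invariantDifferential, Derivation.leibniz_inv, invariantDifferential, smul_smul, smul_smul,
    ← neg_smul]
  congr 1
  field_simp

/-- Write `ω = h dx / y`. The invariant differential at infinity is `-x dx / y`, so regularity of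
`ω` there says that `h / x` is integral; `h` is then a polynomial in `x` of degree at most 1. -/
theorem regularDifferentials_eq (S : DoubleCover d f x y) : regularDifferentials k F =
    Submodule.span k {invariantDifferential k x y, x • invariantDifferential k x y} := by
  have hx := S.x_ne
  have hsw := S.invariantDifferential_swap
  apply le_antisymm
  · intro ω hω
    rw [regularDifferentials, Submodule.mem_iInf] at hω
    obtain ⟨h, rfl⟩ := S.exists_eq_smul ω
    obtain ⟨a, ha, rfl⟩ := S.exists_eq_aeval (n := 1) (by norm_num)
      (fun P hP => S.val_le_of_mem hP (hω P)) (fun P hP => by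
        have h1 : h • invariantDifferential k x y =
            (-(h * x⁻¹)) • invariantDifferential k x⁻¹ (y / x ^ 3) := by
          rw [hsw, neg_smul_neg, smul_smul, mul_assoc, inv_mul_cancel₀ hx, mul_one]
        have h2 := hω P
        rw [h1] at h2
        have := S.swap.val_le_of_mem hP h2
        rwa [Valuation.map_neg, ← pow_one x⁻¹] at this)
    rw [eq_X_add_C_of_natDegree_le_one ha, Submodule.mem_span_pair]
    refine ⟨a.coeff 0, a.coeff 1, ?_⟩
    simp only [map_add, map_mul, aeval_C, aeval_X, add_smul, mul_smul, algebraMap_smul]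
    rw [add_comm]
  · rw [Submodule.span_le, regularDifferentials]
    have key : ∀ P : Place k F, invariantDifferential k x y ∈ P.regularAt ∧
        x • invariantDifferential k x y ∈ P.regularAt := by
      intro P
      rcases le_or_gt (P.val x) 1 with h | h
      · have := S.invariantDifferential_mem h
        exact ⟨this, P.smul_mem_regularAt h this⟩
      · have hu : P.val x⁻¹ ≤ 1 := by
          rw [map_inv₀]
          exact inv_le_one_of_one_le₀ h.le
        have h1 := S.swap.invariantDifferential_mem hu
        rw [hsw] at h1
        have h2 := (Submodule.neg_mem_iff _).1 h1
        refine ⟨?_, h2⟩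
        have h3 := P.smul_mem_regularAt hu h2
        rwa [smul_smul, inv_mul_cancel₀ hx, one_smul] at h3
    rintro ω (rfl | rfl)
    · exact (Submodule.mem_iInf _).2 fun P => (key P).1
    · exact (Submodule.mem_iInf _).2 fun P => (key P).2

theorem genus_eq (S : DoubleCover d f x y) : genus k F = 2 := by
  have hli : LinearIndependent k
      ![invariantDifferential k x y, x • invariantDifferential k x y] := by
    rw [LinearIndependent.pair_iff]
    intro s t h
    have h1 : (aeval x (C s + C t * X)) • invariantDifferential k x y = 0 := by
      simp only [map_add, map_mul, aeval_C, aeval_X, add_smul, mul_smul, algebraMap_smul]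
      exact h
    have h2 := (smul_eq_zero.1 h1).resolve_right S.invariantDifferential_ne
    have h3 : C s + C t * X = 0 := S.aeval_injective (by rw [h2, map_zero])
    have h4 := congrArg (coeff · 0) h3
    have h5 := congrArg (coeff · 1) h3
    simp at h4 h5
    exact ⟨h4, h5⟩
  rw [genus, S.regularDifferentials_eq]
  have := finrank_span_eq_card hli
  rwa [Matrix.range_cons_cons_empty] at this

end DoubleCover
end

/-! ### Orders at places and rational points. -/

noncomputable section

namespace Place

variable {k F : Type*} [Field k] [Field F] [Algebra k F] (P : Place k F) {f g : F}

theorem val_ne_zero (hf : f ≠ 0) : P.val f ≠ 0 := (Valuation.ne_zero_iff _).2 hf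

theorem val_le_one_iff (hf : f ≠ 0) : P.val f ≤ 1 ↔ 0 ≤ P.ord f := by
  rw [ord, neg_nonneg, ← WithZero.log_one, WithZero.log_le_log (P.val_ne_zero hf) one_ne_zero]

theorem val_lt_one_iff (hf : f ≠ 0) : P.val f < 1 ↔ 0 < P.ord f := by
  rw [ord, neg_pos, ← WithZero.log_one, WithZero.log_lt_log (P.val_ne_zero hf) one_ne_zero]

theorem val_eq_one_iff (hf : f ≠ 0) : P.val f = 1 ↔ P.ord f = 0 := by
  rw [le_antisymm_iff, le_antisymm_iff, P.val_le_one_iff hf, and_comm]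
  refine and_congr ?_ Iff.rfl
  rw [ord, neg_nonpos, ← WithZero.log_one, WithZero.log_le_log one_ne_zero (P.val_ne_zero hf)]

theorem val_le_val_iff (hf : f ≠ 0) (hg : g ≠ 0) : P.val f ≤ P.val g ↔ P.ord g ≤ P.ord f := by
  rw [ord, ord, neg_le_neg_iff, WithZero.log_le_log (P.val_ne_zero hf) (P.val_ne_zero hg)]

theorem ord_mul' (hf : f ≠ 0) (hg : g ≠ 0) : P.ord (f * g) = P.ord f + P.ord g :=
  P.ord_mul (Units.mk0 f hf) (Units.mk0 g hg)

theorem ord_inv' (hf : f ≠ 0) : P.ord f⁻¹ = -P.ord f := P.ord_inv (Units.mk0 f hf)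

theorem ord_zpow (n : ℤ) : P.ord (f ^ n) = n * P.ord f := by
  rw [ord, ord, map_zpow₀, WithZero.log_zpow]
  simp

theorem ord_pow (n : ℕ) : P.ord (f ^ n) = n * P.ord f := by
  simpa using P.ord_zpow (f := f) n

theorem ord_algebraMap {c : k} (hc : c ≠ 0) : P.ord (algebraMap k F c) = 0 := by
  rw [ord, P.map_const c hc, WithZero.log_one, neg_zero]

theorem ord_prod {ι : Type*} (s : Finset ι) (g : ι → F) (hg : ∀ i ∈ s, g i ≠ 0) :
    P.ord (∏ i ∈ s, g i) = ∑ i ∈ s, P.ord (g i) := by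
  classical
  induction s using Finset.induction_on with
  | empty => simpa using P.ord_one
  | insert a s ha ih =>
    rw [Finset.prod_insert ha, Finset.sum_insert ha, P.ord_mul' (hg a (by simp))
      (Finset.prod_ne_zero_iff.2 fun i hi => hg i (by simp [hi])),
      ih fun i hi => hg i (by simp [hi])]

theorem exists_ord_eq_one : ∃ t : F, t ≠ 0 ∧ P.ord t = 1 := by
  obtain ⟨t, ht⟩ := P.surj (WithZero.exp (-1))
  have h0 : t ≠ 0 := by
    rintro rfl
    rw [map_zero] at ht
    exact WithZero.exp_ne_zero ht.symm
  exact ⟨t, h0, by rw [ord, ht, WithZero.log_exp, neg_neg]⟩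

theorem ext_ord {P Q : Place k F} (h : ∀ f : F, f ≠ 0 → P.ord f = Q.ord f) : P = Q := by
  ext f
  by_cases hf : f = 0
  · simp [hf]
  · have := neg_injective (h f hf)
    rw [← WithZero.exp_log (P.val_ne_zero hf), this, WithZero.exp_log (Q.val_ne_zero hf)]

/-- Valuation rings of places are maximal. -/
theorem eq_of_integers_le {P Q : Place k F} (h : ∀ f : F, P.val f ≤ 1 → Q.val f ≤ 1) :
    P = Q := by
  obtain ⟨t, ht0, ht⟩ := P.exists_ord_eq_one
  have hu : ∀ u : F, u ≠ 0 → P.ord u = 0 → Q.ord u = 0 := by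
    intro u hu0 hu
    refine le_antisymm ?_ ((Q.val_le_one_iff hu0).1 (h u ((P.val_le_one_iff hu0).2 hu.ge)))
    have hu' := inv_ne_zero hu0
    have := (Q.val_le_one_iff hu').1 (h _ ((P.val_le_one_iff hu').2 (by rw [P.ord_inv' hu0, hu, neg_zero])))
    rw [Q.ord_inv' hu0] at this
    linarith
  -- Units at `P` are units at `Q`, so `Q.ord` is a multiple of `P.ord`; since `Q.ord` also takes
  -- the value 1, the nonnegative factor is 1.
  have key : ∀ f : F, f ≠ 0 → Q.ord f = P.ord f * Q.ord t := by
    intro f hf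
    have htn : t ^ (-P.ord f) ≠ 0 := zpow_ne_zero _ ht0
    have := hu (f * t ^ (-P.ord f)) (mul_ne_zero hf htn) (by
      rw [P.ord_mul' hf htn, P.ord_zpow, ht]; ring)
    rw [Q.ord_mul' hf htn, Q.ord_zpow] at this
    linarith
  have htQ : 0 ≤ Q.ord t :=
    (Q.val_le_one_iff ht0).1 (h t ((P.val_le_one_iff ht0).2 (by rw [ht]; norm_num)))
  obtain ⟨t', ht'0, ht'⟩ := Q.exists_ord_eq_one
  have h1 := key t' ht'0
  rw [ht'] at h1
  have h2 : Q.ord t = 1 := Int.eq_one_of_dvd_one htQ (Dvd.intro_left _ h1.symm)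
  exact ext_ord fun f hf => by rw [key f hf, h2, mul_one]

/-- `P` is the rational point with coordinates `x₀`, `y₀`, a local coordinate being `x - x₀`. -/
structure IsPoint (P : Place k F) (x y : F) (x₀ y₀ : k) : Prop where
  val_x : P.val (x - algebraMap k F x₀) < 1
  val_y : P.val (y - algebraMap k F y₀) < 1
  ord_x : P.ord (x - algebraMap k F x₀) = 1
  degree_eq : P.degree = 1
  unique : ∀ Q : Place k F, Q.val (x - algebraMap k F x₀) < 1 →
    Q.val (y - algebraMap k F y₀) < 1 → Q = P

theorem val_le_of_sub {a : F} {c : k} (h : P.val (a - algebraMap k F c) ≤ 1) : P.val a ≤ 1 := by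
  have := P.val.map_add_le h (P.val_algebraMap_le c)
  rwa [sub_add_cancel] at this

theorem val_eq_one_of_sub {a : F} {c : k} (hc : c ≠ 0) (h : P.val (a - algebraMap k F c) < 1) :
    P.val a = 1 := by
  rw [← P.map_const c hc] at h ⊢
  exact (Valuation.map_eq_of_sub_lt _ h)

theorem eq_zero_of_val_lt_one {c : k} (h : P.val (algebraMap k F c) < 1) : c = 0 := by
  by_contra hc
  exact h.ne (P.map_const c hc)

theorem val_aeval_sub_le {x : F} (hx : P.val x ≤ 1) (a : k[X]) (x₀ : k) :
    P.val (aeval x a - algebraMap k F (a.eval x₀)) ≤ P.val (x - algebraMap k F x₀) := by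
  obtain ⟨q, hq⟩ := X_sub_C_dvd_sub_C_eval (a := x₀) (p := a)
  have := congrArg (aeval x) hq
  simp only [map_sub, map_mul, aeval_X, aeval_C] at this
  rw [this, map_mul]
  exact mul_le_of_le_one_right' (P.val_aeval_le hx q)

theorem val_aeval_sub_lt {x : F} {x₀ : k} (h : P.val (x - algebraMap k F x₀) < 1) (a : k[X]) :
    P.val (aeval x a - algebraMap k F (a.eval x₀)) < 1 :=
  (P.val_aeval_sub_le (P.val_le_of_sub h.le) a x₀).trans_lt h

/-- Evaluation of `a(x) + b(x) y` at a point. -/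
theorem val_sub_le {x y : F} {x₀ y₀ : k} (hx : P.val x ≤ 1) (hy : P.val y ≤ 1)
    (h : P.val (y - algebraMap k F y₀) ≤ P.val (x - algebraMap k F x₀)) (a b : k[X]) :
    P.val (aeval x a + aeval x b * y - algebraMap k F (a.eval x₀ + b.eval x₀ * y₀))
      ≤ P.val (x - algebraMap k F x₀) := by
  have : aeval x a + aeval x b * y - algebraMap k F (a.eval x₀ + b.eval x₀ * y₀) =
      (aeval x a - algebraMap k F (a.eval x₀)) + (aeval x b - algebraMap k F (b.eval x₀)) * y
        + algebraMap k F (b.eval x₀) * (y - algebraMap k F y₀) := by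
    rw [map_add, map_mul]; ring
  rw [this]
  refine P.val.map_add_le (P.val.map_add_le (P.val_aeval_sub_le hx a x₀) ?_) ?_
  · rw [map_mul]
    exact (mul_le_of_le_one_right' hy).trans (P.val_aeval_sub_le hx b x₀)
  · rw [map_mul]
    exact (mul_le_of_le_one_left' (P.val_algebraMap_le _)).trans h

theorem val_sub_lt {x y : F} {x₀ y₀ : k} (h : P.val (x - algebraMap k F x₀) < 1)
    (h' : P.val (y - algebraMap k F y₀) < 1) (a b : k[X]) :
    P.val (aeval x a + aeval x b * y - algebraMap k F (a.eval x₀ + b.eval x₀ * y₀)) < 1 := by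
  have hy := P.val_le_of_sub h'.le
  have : aeval x a + aeval x b * y - algebraMap k F (a.eval x₀ + b.eval x₀ * y₀) =
      (aeval x a - algebraMap k F (a.eval x₀)) + (aeval x b - algebraMap k F (b.eval x₀)) * y
        + algebraMap k F (b.eval x₀) * (y - algebraMap k F y₀) := by
    rw [map_add, map_mul]; ring
  rw [this]
  refine P.val.map_add_lt (P.val.map_add_lt (P.val_aeval_sub_lt h a) ?_) ?_
  · rw [map_mul]
    exact (mul_le_of_le_one_right' hy).trans_lt (P.val_aeval_sub_lt h b)
  · rw [map_mul]
    exact (mul_le_of_le_one_left' (P.val_algebraMap_le _)).trans_lt h'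

/-- A place whose valuation ring is a localization of the coordinate ring, centred at a rational
point with local coordinate `x - x₀`. -/
theorem IsLocalizedAt.isPoint {P : Place k F} {x y : F} (hP : P.IsLocalizedAt x y) {x₀ y₀ : k}
    (hx₀ : P.val (x - algebraMap k F x₀) < 1)
    (hy₀ : P.val (y - algebraMap k F y₀) ≤ P.val (x - algebraMap k F x₀)) :
    P.IsPoint x y x₀ y₀ := by
  set t := x - algebraMap k F x₀ with ht
  have hx := hP.val_le
  have hyt := hy₀.trans_lt hx₀
  have hy := P.val_le_of_sub hyt.le
  -- The constant is the value of the fraction `g` at `(x₀, y₀)`. This one estimate shows both that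
  -- `t` is a uniformizer and that the residue field is `k`.
  have hres : ∀ g : F, P.val g ≤ 1 → ∃ c : k, P.val (g - algebraMap k F c) ≤ P.val t := by
    intro g hg
    obtain ⟨a, b, a', b', hq, e⟩ := hP.exists_den g hg
    have h1 := P.val_sub_le hx hy hy₀ a b
    have h2 := P.val_sub_le hx hy hy₀ a' b'
    set q := aeval x a' + aeval x b' * y
    set p := aeval x a + aeval x b * y
    set p₀ := a.eval x₀ + b.eval x₀ * y₀
    set q₀ := a'.eval x₀ + b'.eval x₀ * y₀
    have hq₀ : q₀ ≠ 0 := by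
      intro h0
      rw [h0, map_zero, sub_zero, hq] at h2
      exact absurd hx₀ (not_lt.2 h2)
    have hq₀' : algebraMap k F q₀ ≠ 0 := (_root_.map_ne_zero _).2 hq₀
    refine ⟨p₀ / q₀, ?_⟩
    have h3 : P.val (g - algebraMap k F (p₀ / q₀)) =
        P.val ((p - algebraMap k F p₀) - algebraMap k F (p₀ / q₀) * (q - algebraMap k F q₀)) := by
      rw [← mul_one (P.val (g - _)), ← hq, ← map_mul]
      congr 1
      rw [sub_mul, e, map_div₀]
      field_simp
      ring
    rw [h3]
    refine P.val.map_sub_le h1 ?_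
    rw [map_mul]
    exact (mul_le_of_le_one_left' (P.val_algebraMap_le _)).trans h2
  have hres' : ∀ g : F, P.val g < 1 → P.val g ≤ P.val t := by
    intro g hg
    obtain ⟨c, hc⟩ := hres g hg.le
    have : c = 0 := by
      apply P.eq_zero_of_val_lt_one
      have := P.val.map_sub_lt hg (hc.trans_lt hx₀)
      rwa [sub_sub_cancel] at this
    rwa [this, map_zero, sub_zero] at hc
  obtain ⟨π, hπ0, hπ⟩ := P.exists_ord_eq_one
  have hπt := hres' π ((P.val_lt_one_iff hπ0).2 (by rw [hπ]; norm_num))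
  have ht0 : t ≠ 0 := by
    intro h
    rw [h, map_zero] at hπt
    exact P.val_ne_zero hπ0 (le_zero_iff.1 hπt)
  refine ⟨hx₀, hyt, ?_, ?_, ?_⟩
  · have h1 := (P.val_lt_one_iff ht0).1 hx₀
    have h2 := (P.val_le_val_iff hπ0 ht0).1 hπt
    rw [hπ] at h2
    exact le_antisymm h2 h1
  · have h1 : (1 : F) ∈ P.integers := by change P.val 1 ≤ 1; simp
    refine finrank_eq_one (Submodule.Quotient.mk ⟨1, h1⟩) ?_ ?_
    · rw [Ne, Submodule.Quotient.mk_eq_zero, Submodule.submoduleOf, Submodule.mem_comap]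
      change ¬ P.val 1 < 1
      simp
    · intro w
      obtain ⟨⟨g, hg⟩, rfl⟩ := Submodule.Quotient.mk_surjective _ w
      obtain ⟨c, hc⟩ := hres g hg
      refine ⟨c, ?_⟩
      rw [← Submodule.Quotient.mk_smul, Submodule.Quotient.eq, Submodule.submoduleOf, Submodule.mem_comap]
      change P.val (c • 1 - g) < 1
      rw [← Algebra.algebraMap_eq_smul_one, Valuation.map_sub_swap]
      exact hc.trans_lt hx₀
  · intro Q hQx hQy
    refine (eq_of_integers_le fun g hg => ?_).symm
    obtain ⟨a, b, a', b', hq, e⟩ := hP.exists_den g hg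
    have h2 := P.val_sub_le hx hy hy₀ a' b'
    have h3 := Q.val_sub_lt hQx hQy a b
    have h4 := Q.val_sub_lt hQx hQy a' b'
    have hq₀ : a'.eval x₀ + b'.eval x₀ * y₀ ≠ 0 := by
      intro h0
      rw [h0, map_zero, sub_zero, hq] at h2
      exact absurd hx₀ (not_lt.2 h2)
    have h5 := Q.val_eq_one_of_sub hq₀ h4
    have h6 := Q.val_le_of_sub h3.le
    rwa [← e, map_mul, h5, mul_one] at h6

end Place

namespace DoubleCover

variable {k F : Type*} [Field k] [Field F] [Algebra k F] {d : k} {f : k[X]} {x y : F}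

/-- The function `(y + y₀) / (x - x₀)` is not in the coordinate ring because `y₀ ≠ 0`, so it has a
pole at some affine place. There `x - x₀` vanishes, and as `x - x₀` divides `(y - y₀)(y + y₀)`, the
pole forces `y - y₀` to vanish. Then `y + y₀` is a unit, and `y - y₀` is divisible by `x - x₀`. -/
theorem exists_isPoint (S : DoubleCover d f x y) {x₀ y₀ : k} (h : d * y₀ ^ 2 = f.eval x₀)
    (hy₀ : y₀ ≠ 0) : ∃ P : Place k F, P.IsPoint x y x₀ y₀ := by
  have ht : x - algebraMap k F x₀ ≠ 0 := by
    have := S.aeval_ne_zero (X_sub_C_ne_zero x₀)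
    simpa using this
  obtain ⟨P, hP, hg⟩ := S.exists_place (h := (y + algebraMap k F y₀) / (x - algebraMap k F x₀)) (by
    rintro ⟨a, b, e⟩
    rw [div_eq_iff ht] at e
    have := (S.indep (a * (X - C x₀) - C y₀) (b * (X - C x₀) - 1) (by
      simp only [map_sub, map_mul, aeval_X, aeval_C, map_one]
      linear_combination -e)).1
    have := congrArg (eval x₀) this
    simp at this
    exact hy₀ this)
  have hx := hP.val_le
  have hy := S.val_y_le hx
  have hplus : P.val (y + algebraMap k F y₀) ≤ 1 := P.val.map_add_le hy (P.val_algebraMap_le _)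
  rw [map_div₀] at hg
  have htv : P.val (x - algebraMap k F x₀) ≠ 0 := P.val_ne_zero ht
  have hx₀ : P.val (x - algebraMap k F x₀) < 1 := by
    rw [one_lt_div₀ (zero_lt_iff.2 htv)] at hg
    exact hg.trans_le hplus
  have hprod : P.val (y - algebraMap k F y₀) * P.val (y + algebraMap k F y₀)
      ≤ P.val (x - algebraMap k F x₀) := by
    have := P.val_aeval_sub_le hx f x₀
    rw [← S.eqn, ← h, map_mul, map_pow, ← mul_sub, map_mul, P.map_const d S.d_ne, one_mul] at this
    rw [← map_mul]
    convert this using 2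
    ring
  have hlt : P.val (y - algebraMap k F y₀) < 1 := by
    rw [one_lt_div₀ (zero_lt_iff.2 htv)] at hg
    by_contra! h1
    have := (le_mul_of_one_le_left' h1).trans hprod
    exact absurd hg (not_lt.2 this)
  have hone : P.val (y + algebraMap k F y₀) = 1 := by
    refine P.val_eq_one_of_sub (c := 2 * y₀) (mul_ne_zero S.two_ne hy₀) ?_
    convert hlt using 2
    rw [map_mul, map_ofNat]
    ring
  rw [hone, mul_one] at hprod
  exact ⟨P, hP.isPoint hx₀ hprod⟩

end DoubleCover
end

/-! ### Points at infinity and the divisor of `y - m(x)`. -/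

noncomputable section

namespace DoubleCover

variable {k F : Type*} [Field k] [Field F] [Algebra k F] {d : k} {f : k[X]} {x y : F}

section AtInfinity

variable {δ : k} {P : Place k F}

theorem _root_.Place.IsPoint.ord_x_atInfinity (S : DoubleCover d f x y)
    (h : P.IsPoint x⁻¹ (y / x ^ 3) 0 δ) : P.ord x = -1 := by
  have := h.ord_x
  rw [map_zero, sub_zero, P.ord_inv' S.x_ne] at this
  linarith

theorem _root_.Place.IsPoint.one_lt_val_x (S : DoubleCover d f x y)
    (h : P.IsPoint x⁻¹ (y / x ^ 3) 0 δ) : 1 < P.val x := by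
  rw [← not_le, P.val_le_one_iff S.x_ne, h.ord_x_atInfinity S]
  norm_num

end AtInfinity

theorem eval_reflect_six_zero (f : k[X]) : (f.reflect 6).eval 0 = f.coeff 6 := by
  rw [← coeff_zero_eq_eval_zero, coeff_reflect, revAt_zero]

theorem exists_isPoint_atInfinity (S : DoubleCover d f x y) {δ : k} (hδ : d * δ ^ 2 = f.coeff 6)
    (hδ0 : δ ≠ 0) : ∃ P : Place k F, P.IsPoint x⁻¹ (y / x ^ 3) 0 δ :=
  S.swap.exists_isPoint (hδ.trans (eval_reflect_six_zero f).symm) hδ0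

/-- At a pole of `x` the function `(y / x³)² - δ²` vanishes, so one of its two factors does, and a
rational point is determined by its coordinates. -/
theorem place_cases (S : DoubleCover d f x y) {δ : k} (hδ : d * δ ^ 2 = f.coeff 6)
    {P₁ P₂ : Place k F} (h₁ : P₁.IsPoint x⁻¹ (y / x ^ 3) 0 δ)
    (h₂ : P₂.IsPoint x⁻¹ (y / x ^ 3) 0 (-δ)) (Q : Place k F) :
    Q.val x ≤ 1 ∨ Q = P₁ ∨ Q = P₂ := by
  rcases le_or_gt (Q.val x) 1 with h | h
  · exact Or.inl h
  right
  have hu : Q.val (x⁻¹ - algebraMap k F 0) < 1 := by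
    rw [map_zero, sub_zero, map_inv₀]
    exact inv_lt_one_of_one_lt₀ h
  have h3 := Q.val_aeval_sub_lt hu (f.reflect 6)
  rw [eval_reflect_six_zero, ← hδ, ← S.swap.eqn, map_mul, map_pow, ← mul_sub, map_mul,
    Q.map_const d S.d_ne, one_mul, sq_sub_sq, map_mul] at h3
  have h4 : Q.val (y / x ^ 3 - algebraMap k F δ) < 1 ∨
      Q.val (y / x ^ 3 - algebraMap k F (-δ)) < 1 := by
    by_contra! h5
    rw [map_neg, sub_neg_eq_add] at h5
    exact absurd h3 (not_lt.2 (one_le_mul h5.2 h5.1))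
  exact h4.imp (h₁.unique Q hu) (h₂.unique Q hu)

theorem sub_aeval_ne_zero (S : DoubleCover d f x y) (m : k[X]) : y - aeval x m ≠ 0 := by
  intro h
  refine one_ne_zero (S.indep (-m) 1 ?_).2
  rw [map_neg, map_one]
  linear_combination h

theorem add_aeval_ne_zero (S : DoubleCover d f x y) (m : k[X]) : y + aeval x m ≠ 0 := by
  have := S.sub_aeval_ne_zero (-m)
  rwa [map_neg, sub_neg_eq_add] at this

theorem sub_algebraMap_ne_zero (S : DoubleCover d f x y) (a : k) : x - algebraMap k F a ≠ 0 := by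
  have := S.aeval_ne_zero (X_sub_C_ne_zero a)
  simpa using this

theorem neg_le_ord (S : DoubleCover d f x y) {δ : k} (hδ : δ ≠ 0) {P : Place k F}
    (hP : P.IsPoint x⁻¹ (y / x ^ 3) 0 δ) {n : ℕ} (hn : 3 ≤ n) {m : k[X]} (hm : m.natDegree ≤ n) :
    -(n : ℤ) ≤ P.ord (y - aeval x m) := by
  have hx := S.x_ne
  have hxn := pow_ne_zero n hx
  have hg := S.sub_aeval_ne_zero m
  have hu : P.val x⁻¹ ≤ 1 := by
    rw [map_inv₀]
    exact inv_le_one_of_one_le₀ (hP.one_lt_val_x S).le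
  have h1 : P.val ((y - aeval x m) * (x ^ n)⁻¹) ≤ 1 := by
    have : (y - aeval x m) * (x ^ n)⁻¹ = y / x ^ 3 * x⁻¹ ^ (n - 3) - aeval x⁻¹ (m.reflect n) := by
      rw [← aeval_inv_reflect hx hm]
      have : x ^ n = x ^ 3 * x ^ (n - 3) := by rw [← pow_add]; congr 1; omega
      rw [sub_mul, mul_assoc, mul_inv_cancel₀ hxn, mul_one, this, inv_pow]
      congr 1
      field_simp
    rw [this]
    refine P.val.map_sub_le ?_ (P.val_aeval_le hu _)
    rw [map_mul, map_pow]
    exact mul_le_one' (P.val_eq_one_of_sub hδ hP.val_y).le (pow_le_one' hu _)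
  rw [P.val_le_one_iff (mul_ne_zero hg (inv_ne_zero hxn)), P.ord_mul' hg (inv_ne_zero hxn),
    P.ord_inv' hxn, P.ord_pow, hP.ord_x_atInfinity S] at h1
  linarith

section Norm

variable {ι : Type*} [Fintype ι] {e : ι → ℕ} {a : ι → k} {m : k[X]} {κ : k}

theorem ord_norm (S : DoubleCover d f x y) (hκ : κ ≠ 0)
    (hN : f - C d * m ^ 2 = C κ * ∏ i, (X - C (a i)) ^ e i) (Q : Place k F) :
    Q.ord (y - aeval x m) + Q.ord (y + aeval x m)
      = ∑ i, (e i : ℤ) * Q.ord (x - algebraMap k F (a i)) := by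
  have h := congrArg (aeval x) hN
  simp only [map_sub, map_mul, map_pow, map_prod, aeval_X, aeval_C, ← S.eqn] at h
  have hprod : ∀ i ∈ Finset.univ, (x - algebraMap k F (a i)) ^ e i ≠ 0 := fun i _ =>
    pow_ne_zero _ (S.sub_algebraMap_ne_zero (a i))
  have h1 := congrArg Q.ord h
  rw [show algebraMap k F d * y ^ 2 - algebraMap k F d * aeval x m ^ 2 =
      algebraMap k F d * ((y - aeval x m) * (y + aeval x m)) by ring,
    Q.ord_mul' S.d_ne' (mul_ne_zero (S.sub_aeval_ne_zero m) (S.add_aeval_ne_zero m)),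
    Q.ord_mul' (S.sub_aeval_ne_zero m) (S.add_aeval_ne_zero m),
    Q.ord_mul' ((_root_.map_ne_zero _).2 hκ) (Finset.prod_ne_zero_iff.2 hprod),
    Q.ord_algebraMap hκ, Q.ord_algebraMap S.d_ne, Q.ord_prod _ _ hprod, zero_add, zero_add] at h1
  rw [h1]
  exact Finset.sum_congr rfl fun i _ => Q.ord_pow _

/-- A zero of `y - m(x)` in the affine part is a zero of the norm, so it lies over some `a i` and is
the point `A i`. The family may repeat points: only the sum of the exponents at each place matters.
-/
theorem ord_sub_aeval_of_val_le (S : DoubleCover d f x y) (hκ : κ ≠ 0)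
    (hN : f - C d * m ^ 2 = C κ * ∏ i, (X - C (a i)) ^ e i) {A : ι → Place k F}
    (hA : ∀ i, (A i).IsPoint x y (a i) (m.eval (a i))) (hm : ∀ i, m.eval (a i) ≠ 0)
    {Q : Place k F} (hQ : Q.val x ≤ 1) :
    Q.ord (y - aeval x m) = (∑ i, Finsupp.single (A i) (e i : ℤ)) Q := by
  classical
  have hsum := S.ord_norm hκ hN Q
  have hg := S.sub_aeval_ne_zero m
  have hg' := S.add_aeval_ne_zero m
  have hy := S.val_y_le hQ
  have hmx := Q.val_aeval_le hQ m
  have hord : 0 ≤ Q.ord (y - aeval x m) := (Q.val_le_one_iff hg).1 (Q.val.map_sub_le hy hmx)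
  have hord' : 0 ≤ Q.ord (y + aeval x m) := (Q.val_le_one_iff hg').1 (Q.val.map_add_le hy hmx)
  have hx : ∀ i, 0 ≤ Q.ord (x - algebraMap k F (a i)) := fun i =>
    (Q.val_le_one_iff (S.sub_algebraMap_ne_zero _)).1
      (Q.val.map_sub_le hQ (Q.val_algebraMap_le _))
  have huniq : Q.val (y - aeval x m) < 1 → ∀ i, 0 < Q.ord (x - algebraMap k F (a i)) →
      Q = A i := by
    intro h i hi
    have h1 := (Q.val_lt_one_iff (S.sub_algebraMap_ne_zero _)).2 hi
    refine (hA i).unique Q h1 ?_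
    have := Q.val.map_add_lt h (Q.val_aeval_sub_lt h1 m)
    rwa [sub_add_sub_cancel] at this
  rw [Finsupp.finsetSum_apply]
  by_cases hQA : ∃ i, Q = A i
  · obtain ⟨i, hi⟩ := hQA
    have h1 := (hA i).val_x
    have h2 := (hA i).val_y
    rw [← hi] at h1 h2
    have h3 := Q.val_aeval_sub_lt h1 m
    have hlt : Q.val (y - aeval x m) < 1 := by
      have := Q.val.map_sub_lt h2 h3
      rwa [sub_sub_sub_cancel_right] at this
    -- At `A i` the conjugate factor takes the value `2 m(a i) ≠ 0`, so the whole order of the norm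
    -- belongs to `y - m(x)`.
    have hg0 : Q.ord (y + aeval x m) = 0 := by
      rw [← Q.val_eq_one_iff hg']
      refine Q.val_eq_one_of_sub (c := 2 * m.eval (a i)) (mul_ne_zero S.two_ne (hm i)) ?_
      have := Q.val.map_add_lt h2 h3
      convert this using 2
      rw [map_mul, map_ofNat]
      ring
    rw [hg0, add_zero] at hsum
    rw [hsum]
    refine Finset.sum_congr rfl fun j _ => ?_
    rw [Finsupp.single_apply]
    split_ifs with h
    · rw [← h, (hA j).ord_x, mul_one]
    · have : Q.ord (x - algebraMap k F (a j)) = 0 := by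
        refine le_antisymm ?_ (hx j)
        by_contra! h4
        exact h (huniq hlt j h4).symm
      rw [this, mul_zero]
  · push Not at hQA
    rw [Finset.sum_eq_zero fun i _ => Finsupp.single_eq_of_ne (hQA i)]
    refine le_antisymm ?_ hord
    by_contra! h
    have : ∃ i, 0 < Q.ord (x - algebraMap k F (a i)) := by
      by_contra! h0
      have : ∑ i, (e i : ℤ) * Q.ord (x - algebraMap k F (a i)) ≤ 0 :=
        Finset.sum_nonpos fun i _ => mul_nonpos_of_nonneg_of_nonpos (by positivity) (h0 i)
      linarith
    obtain ⟨i, hi⟩ := this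
    exact hQA i (huniq ((Q.val_lt_one_iff hg).2 h) i hi)

/-- The divisor of `y - m(x)`, read off from a factorization of its norm. -/
theorem ord_sub_aeval (S : DoubleCover d f x y) (hκ : κ ≠ 0)
    (hN : f - C d * m ^ 2 = C κ * ∏ i, (X - C (a i)) ^ e i) {A : ι → Place k F}
    (hA : ∀ i, (A i).IsPoint x y (a i) (m.eval (a i))) (hm : ∀ i, m.eval (a i) ≠ 0)
    {n : ℕ} (hn : 3 ≤ n) (hmn : m.natDegree ≤ n) (hen : ∑ i, e i = 2 * n)
    {δ : k} (hδ : d * δ ^ 2 = f.coeff 6) (hδ0 : δ ≠ 0)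
    {P₁ P₂ : Place k F} (h₁ : P₁.IsPoint x⁻¹ (y / x ^ 3) 0 δ)
    (h₂ : P₂.IsPoint x⁻¹ (y / x ^ 3) 0 (-δ)) (Q : Place k F) :
    Q.ord (y - aeval x m) = (∑ i, Finsupp.single (A i) (e i : ℤ)
      - n • (Finsupp.single P₁ 1 + Finsupp.single P₂ 1) : Divisor k F) Q := by
  classical
  have hne : P₁ ≠ P₂ := by
    rintro rfl
    have := P₁.val.map_sub_lt h₁.val_y h₂.val_y
    have h3 : P₁.val (algebraMap k F (2 * δ)) < 1 := by
      rw [Valuation.map_sub_swap] at this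
      convert this using 2
      rw [map_mul, map_ofNat, map_neg]
      ring
    exact mul_ne_zero S.two_ne hδ0 (P₁.eq_zero_of_val_lt_one h3)
  -- Both `y - m` and `y + m` have order at least `-n` at infinity, and the norm, of degree `2 n`,
  -- has order exactly `-2 n`; hence both bounds are attained.
  have hinf : ∀ {η : k} (hη : η ≠ 0) {P : Place k F}, P.IsPoint x⁻¹ (y / x ^ 3) 0 η →
      P.ord (y - aeval x m) = -(n : ℤ) ∧ ∀ i, A i ≠ P := by
    intro η hη P hP
    have hx1 := hP.one_lt_val_x S
    constructor
    · have h3 := S.neg_le_ord hη hP hn hmn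
      have h4 := S.neg_le_ord hη hP hn (m := -m) (by rwa [natDegree_neg])
      rw [map_neg, sub_neg_eq_add] at h4
      have h5 := S.ord_norm hκ hN P
      have h6 : ∀ i, P.ord (x - algebraMap k F (a i)) = -1 := by
        intro i
        rw [Place.ord, Valuation.map_sub_eq_of_lt_left _
          ((P.val_algebraMap_le _).trans_lt hx1)]
        exact hP.ord_x_atInfinity S
      rw [Finset.sum_congr rfl fun i _ => by rw [h6 i], ← Finset.sum_mul, ← Nat.cast_sum, hen] at h5
      push_cast at h5
      linarith
    · rintro i rfl
      exact absurd hx1 (not_lt.2 ((A i).val_le_of_sub (hA i).val_x.le))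
  have hsum0 : ∀ P, (∀ i, A i ≠ P) → (∑ i, Finsupp.single (A i) (e i : ℤ)) P = 0 := by
    intro P hP
    rw [Finsupp.finsetSum_apply]
    exact Finset.sum_eq_zero fun i _ => Finsupp.single_eq_of_ne (hP i).symm
  rcases S.place_cases hδ h₁ h₂ Q with hQ | rfl | rfl
  · rw [S.ord_sub_aeval_of_val_le hκ hN hA hm hQ]
    have hQ1 : Q ≠ P₁ := by
      rintro rfl
      exact absurd hQ (not_le.2 (h₁.one_lt_val_x S))
    have hQ2 : Q ≠ P₂ := by
      rintro rfl
      exact absurd hQ (not_le.2 (h₂.one_lt_val_x S))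
    simp [Finsupp.single_eq_of_ne hQ1, Finsupp.single_eq_of_ne hQ2]
  · obtain ⟨h3, h4⟩ := hinf hδ0 h₁
    rw [h3, Finsupp.sub_apply, hsum0 _ h4]
    simp [Finsupp.single_eq_of_ne hne]
  · obtain ⟨h3, h4⟩ := hinf (neg_ne_zero.2 hδ0) h₂
    rw [h3, Finsupp.sub_apply, hsum0 _ h4]
    simp [Finsupp.single_eq_of_ne hne.symm]

end Norm

end DoubleCover
end

/-! ### Invariant divisors and criteria for non-principality. -/

noncomputable section

theorem Divisor.degree_single {k F : Type*} [Field k] [CommRing F] [Algebra k F]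
    (P : Place k F) (n : ℤ) : Divisor.degree k F (Finsupp.single P n) = n * P.degree := by
  simp [Divisor.degree]

/-- The divisor of an invariant function is invariant, and division by `n` in `ℤ` is unique. So `D`
is fixed as a divisor, even if its points are permuted. -/
theorem SemilinearAut.divisorMap_eq_self {k F : Type*} [Field k] [Field F] [Algebra k F]
    (e : SemilinearAut k F) {D : Divisor k F} {n : ℤ} (hn : n ≠ 0) {g : F}
    (hg : e.toEquiv g = g) (hD : ∀ Q, n * D Q = Q.ord g) : e.divisorMap D = D := by
  ext Q
  change D (e.symm.comapPlace Q) = D Q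
  apply mul_left_cancel₀ hn
  rw [hD, hD]
  change -WithZero.log (Q.val (e.toEquiv.symm g)) = _
  rw [(e.toEquiv.symm_apply_eq).2 hg.symm]
  rfl

theorem Place.IsPoint.eq_of_isPoint {k F : Type*} [Field k] [Field F] [Algebra k F]
    {P : Place k F} {x y : F} {x₀ y₀ x₁ y₁ : k} (h : P.IsPoint x y x₀ y₀)
    (h' : P.IsPoint x y x₁ y₁) : y₀ = y₁ := by
  have := P.val.map_sub_lt h'.val_y h.val_y
  rw [sub_sub_sub_cancel_left, ← map_sub] at this
  exact sub_eq_zero.1 (P.eq_zero_of_val_lt_one this)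

namespace DoubleCover

variable {k F : Type*} [Field k] [Field F] [Algebra k F] {d : k} {f : k[X]} {x y : F}
  {δ : k} {P₁ P₂ : Place k F}

theorem exists_eq_aeval_of_ord (S : DoubleCover d f x y) (hδ : d * δ ^ 2 = f.coeff 6)
    (h₁ : P₁.IsPoint x⁻¹ (y / x ^ 3) 0 δ) (h₂ : P₂.IsPoint x⁻¹ (y / x ^ 3) 0 (-δ))
    {n : ℕ} (hn : n ≤ 2) {h : F} (h0 : h ≠ 0)
    (hfin : ∀ Q : Place k F, Q ≠ P₁ → Q ≠ P₂ → 0 ≤ Q.ord h)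
    (hP₁ : -(n : ℤ) ≤ P₁.ord h) (hP₂ : -(n : ℤ) ≤ P₂.ord h) :
    ∃ a : k[X], a.natDegree ≤ n ∧ h = aeval x a := by
  have hx := S.x_ne
  have hle : ∀ Q : Place k F, Q.val x ≤ 1 → Q.val h ≤ 1 := by
    intro Q hQ
    refine (Q.val_le_one_iff h0).2 (hfin Q ?_ ?_)
    · rintro rfl
      exact absurd hQ (not_le.2 (h₁.one_lt_val_x S))
    · rintro rfl
      exact absurd hQ (not_le.2 (h₂.one_lt_val_x S))
  have hpole : ∀ {η : k} {P : Place k F}, P.IsPoint x⁻¹ (y / x ^ 3) 0 η →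
      -(n : ℤ) ≤ P.ord h → P.val (h * x⁻¹ ^ n) ≤ 1 := by
    intro η P hP hord
    have hu := pow_ne_zero n (inv_ne_zero hx)
    rw [P.val_le_one_iff (mul_ne_zero h0 hu), P.ord_mul' h0 hu, P.ord_pow, P.ord_inv' hx,
      hP.ord_x_atInfinity S]
    linarith
  refine S.exists_eq_aeval hn (fun P hP => hle P hP.val_le) fun P hP => ?_
  rcases S.place_cases hδ h₁ h₂ P with h | rfl | rfl
  · rw [map_mul, map_pow]
    exact mul_le_one' (hle P h) (pow_le_one' hP.val_le n)
  · exact hpole h₁ hP₁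
  · exact hpole h₂ hP₂

/-- The sum of two points minus the two points at infinity. -/
def _root_.Divisor.pair (A B P₁ P₂ : Place k F) : Divisor k F :=
  Finsupp.single A 1 + Finsupp.single B 1 - (Finsupp.single P₁ 1 + Finsupp.single P₂ 1)

theorem _root_.Divisor.degree_pair {A B P₁ P₂ : Place k F} (hA : A.degree = 1)
    (hB : B.degree = 1) (h₁ : P₁.degree = 1) (h₂ : P₂.degree = 1) :
    Divisor.degree k F (Divisor.pair A B P₁ P₂) = 0 := by
  simp only [Divisor.pair, map_sub, map_add, Divisor.degree_single, hA, hB, h₁, h₂]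
  norm_num

theorem _root_.Place.IsPoint.ne_atInfinity (S : DoubleCover d f x y) {A : Place k F} {x₀ y₀ : k}
    (hA : A.IsPoint x y x₀ y₀) (h₁ : P₁.IsPoint x⁻¹ (y / x ^ 3) 0 δ) : A ≠ P₁ := by
  rintro rfl
  exact absurd (h₁.one_lt_val_x S) (not_lt.2 (A.val_le_of_sub hA.val_x.le))

theorem atInfinity_ne (S : DoubleCover d f x y) (hδ : δ ≠ 0)
    (h₁ : P₁.IsPoint x⁻¹ (y / x ^ 3) 0 δ) (h₂ : P₂.IsPoint x⁻¹ (y / x ^ 3) 0 (-δ)) :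
    P₁ ≠ P₂ := by
  rintro rfl
  have := h₁.eq_of_isPoint h₂
  exact mul_ne_zero S.two_ne hδ (by linear_combination this)

open Classical in
/-- A principal multiple `n • (A + B - P₁ - P₂)`, with `n ≤ 2`, is the divisor of a polynomial
in `x`. -/
theorem exists_aeval_of_pair_principal (S : DoubleCover d f x y) (hδ : d * δ ^ 2 = f.coeff 6)
    (hδ0 : δ ≠ 0)
    (h₁ : P₁.IsPoint x⁻¹ (y / x ^ 3) 0 δ) (h₂ : P₂.IsPoint x⁻¹ (y / x ^ 3) 0 (-δ))
    {A B : Place k F} {a₁ a₂ b₁ b₂ : k} (hA : A.IsPoint x y a₁ a₂) (hB : B.IsPoint x y b₁ b₂)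
    {n : ℕ} (hn : n ≤ 2) (h : n • Divisor.pair A B P₁ P₂ ∈ Divisor.principal k F) :
    ∃ a : k[X], a ≠ 0 ∧ a.natDegree ≤ n ∧ ∀ Q : Place k F, Q ≠ P₁ → Q ≠ P₂ →
      Q.ord (aeval x a) = n * ((if A = Q then 1 else 0) + (if B = Q then 1 else 0)) := by
  obtain ⟨g, hg⟩ := h
  have hne := S.atInfinity_ne hδ0 h₁ h₂
  have hfin : ∀ Q : Place k F, Q ≠ P₁ → Q ≠ P₂ →
      Q.ord (g : F) = n * ((if A = Q then 1 else 0) + (if B = Q then 1 else 0)) := by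
    intro Q hQ1 hQ2
    rw [← hg]
    simp [Divisor.pair, Finsupp.single_apply, hQ1.symm, hQ2.symm]
  have hA1 := hA.ne_atInfinity S h₁
  have hA2 := hA.ne_atInfinity S h₂
  have hB1 := hB.ne_atInfinity S h₁
  have hB2 := hB.ne_atInfinity S h₂
  obtain ⟨a, ha, e⟩ := S.exists_eq_aeval_of_ord hδ h₁ h₂ hn g.ne_zero (fun Q hQ1 hQ2 => by
      rw [hfin Q hQ1 hQ2]; positivity)
    (by rw [← hg]; simp [Divisor.pair, hA1, hB1, hne.symm])
    (by rw [← hg]; simp [Divisor.pair, hA2, hB2, hne])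
  refine ⟨a, ?_, ha, fun Q hQ1 hQ2 => by rw [← e, hfin Q hQ1 hQ2]⟩
  rintro rfl
  exact g.ne_zero (by rw [e, map_zero])

theorem eval_eq_zero_of_ord_pos (S : DoubleCover d f x y) {A : Place k F} {a₁ a₂ : k}
    (hA : A.IsPoint x y a₁ a₂) {a : k[X]} (ha : a ≠ 0) (h : 0 < A.ord (aeval x a)) :
    a.eval a₁ = 0 := by
  apply A.eq_zero_of_val_lt_one
  have h1 := A.val_aeval_sub_lt hA.val_x a
  have h2 := A.val.map_sub_lt ((A.val_lt_one_iff (S.aeval_ne_zero ha)).2 h) h1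
  rwa [sub_sub_cancel] at h2

/-- Two points with the same nonzero `y`-coordinate: twice their sum is not equivalent to twice
the divisor at infinity. -/
theorem two_nsmul_pair_notMem (S : DoubleCover d f x y) (hδ : d * δ ^ 2 = f.coeff 6)
    (hδ0 : δ ≠ 0)
    (h₁ : P₁.IsPoint x⁻¹ (y / x ^ 3) 0 δ) (h₂ : P₂.IsPoint x⁻¹ (y / x ^ 3) 0 (-δ))
    {A B : Place k F} {a b c : k} (hA : A.IsPoint x y a c) (hB : B.IsPoint x y b c)
    (hc : c ≠ 0) (hac : d * c ^ 2 = f.eval a) :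
    2 • Divisor.pair A B P₁ P₂ ∉ Divisor.principal k F := by
  intro h
  obtain ⟨p, hp0, -, hp⟩ := S.exists_aeval_of_pair_principal hδ hδ0 h₁ h₂ hA hB le_rfl h
  -- A polynomial in `x` vanishing at `A` also vanishes at its hyperelliptic conjugate `A'`. But
  -- `A'` has `y`-coordinate `-c ≠ c`, so it is neither `A` nor `B`.
  obtain ⟨A', hA'⟩ := S.exists_isPoint (x₀ := a) (y₀ := -c) (by rw [neg_sq, hac])
    (neg_ne_zero.2 hc)
  have hcc : c ≠ -c := fun h => mul_ne_zero S.two_ne hc (by linear_combination h)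
  have hAA' : A ≠ A' := by
    rintro rfl
    exact hcc (hA.eq_of_isPoint hA')
  have hBA' : B ≠ A' := by
    rintro rfl
    exact hcc (hB.eq_of_isPoint hA')
  have h3 := hp A (hA.ne_atInfinity S h₁) (hA.ne_atInfinity S h₂)
  have h4 := S.eval_eq_zero_of_ord_pos hA hp0 (by
    rw [h3, if_pos rfl]; split_ifs <;> norm_num)
  have h5 := hp A' (hA'.ne_atInfinity S h₁) (hA'.ne_atInfinity S h₂)
  rw [if_neg hAA', if_neg hBA', add_zero, mul_zero] at h5
  have h6 := A'.val_aeval_sub_lt hA'.val_x p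
  rw [h4, map_zero, sub_zero, A'.val_lt_one_iff (S.aeval_ne_zero hp0)] at h6
  omega

/-- Two points with distinct `x`-coordinates: their sum is not equivalent to the divisor at
infinity. -/
theorem pair_notMem (S : DoubleCover d f x y) (hδ : d * δ ^ 2 = f.coeff 6)
    (hδ0 : δ ≠ 0)
    (h₁ : P₁.IsPoint x⁻¹ (y / x ^ 3) 0 δ) (h₂ : P₂.IsPoint x⁻¹ (y / x ^ 3) 0 (-δ))
    {A B : Place k F} {a₁ a₂ b₁ b₂ : k} (hA : A.IsPoint x y a₁ a₂) (hB : B.IsPoint x y b₁ b₂)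
    (hab : a₁ ≠ b₁) : Divisor.pair A B P₁ P₂ ∉ Divisor.principal k F := by
  intro h
  rw [← one_nsmul (Divisor.pair A B P₁ P₂)] at h
  obtain ⟨p, hp0, hp1, hp⟩ :=
    S.exists_aeval_of_pair_principal hδ hδ0 h₁ h₂ hA hB one_le_two h
  have h3 := S.eval_eq_zero_of_ord_pos hA hp0 (by
    rw [hp A (hA.ne_atInfinity S h₁) (hA.ne_atInfinity S h₂), if_pos rfl]
    split_ifs <;> norm_num)
  have h4 := S.eval_eq_zero_of_ord_pos hB hp0 (by
    rw [hp B (hB.ne_atInfinity S h₁) (hB.ne_atInfinity S h₂), if_pos rfl]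
    split_ifs <;> norm_num)
  rw [eq_X_add_C_of_natDegree_le_one hp1] at h3 h4 hp0
  simp only [eval_add, eval_mul, eval_C, eval_X] at h3 h4
  have h5 : p.coeff 1 = 0 :=
    (mul_eq_zero.1 (by linear_combination h3 - h4 : p.coeff 1 * (a₁ - b₁) = 0)).resolve_right
      (sub_ne_zero.2 hab)
  have h6 : p.coeff 0 = 0 := by linear_combination h3 - a₁ * h5
  exact hp0 (by rw [h5, h6]; simp)

/-- The two points at infinity are not equivalent. -/
theorem atInfinity_notMem (S : DoubleCover d f x y) (hδ : d * δ ^ 2 = f.coeff 6)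
    (hδ0 : δ ≠ 0)
    (h₁ : P₁.IsPoint x⁻¹ (y / x ^ 3) 0 δ) (h₂ : P₂.IsPoint x⁻¹ (y / x ^ 3) 0 (-δ)) :
    (Finsupp.single P₁ 1 - Finsupp.single P₂ 1 : Divisor k F) ∉ Divisor.principal k F := by
  rintro ⟨g, hg⟩
  have hne := S.atInfinity_ne hδ0 h₁ h₂
  have hg1 : P₁.ord (g : F) = 1 := by rw [← hg]; simp [hne.symm]
  have hg2 : P₂.ord (g : F) = -1 := by rw [← hg]; simp [hne]
  obtain ⟨p, hp1, e⟩ := S.exists_eq_aeval_of_ord (n := 1) hδ h₁ h₂ one_le_two g.ne_zero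
    (fun Q hQ1 hQ2 => by rw [← hg]; simp [hQ1.symm, hQ2.symm])
    (by rw [hg1]; norm_num) (by rw [hg2]; norm_num)
  have hp0 : p ≠ 0 := by
    rintro rfl
    exact g.ne_zero (by rw [e, map_zero])
  rw [e, eq_X_add_C_of_natDegree_le_one hp1] at hg1
  rw [eq_X_add_C_of_natDegree_le_one hp1] at hp0
  -- A polynomial in `x` of degree at most 1 has order 0 or -1 at `P₁`, never 1.
  by_cases h1 : p.coeff 1 = 0
  · have h0 : p.coeff 0 ≠ 0 := by
      intro h0
      exact hp0 (by rw [h0, h1]; simp)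
    rw [h1, C_0, zero_mul, zero_add, aeval_C, P₁.ord_algebraMap h0] at hg1
    exact zero_ne_one hg1
  · have hlt : P₁.val (algebraMap k F (p.coeff 0)) <
        P₁.val (algebraMap k F (p.coeff 1) * x) := by
      rw [map_mul, P₁.map_const _ h1, one_mul]
      exact (P₁.val_algebraMap_le _).trans_lt (h₁.one_lt_val_x S)
    simp only [map_add, map_mul, aeval_C, aeval_X] at hg1
    rw [Place.ord, Valuation.map_add_eq_of_lt_left _ hlt, map_mul, P₁.map_const _ h1,
      one_mul] at hg1
    have := h₁.ord_x_atInfinity S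
    rw [Place.ord, hg1] at this
    norm_num at this

end DoubleCover
end

/-! ### Explicit divisors of order 8 and 3. -/

noncomputable section

/-- The equation `y = 32 d - (x² - e)`. -/
def tangentQuadratic {k : Type*} [Field k] (d e : k) : k[X] := C (32 * d) - (X ^ 2 - C e)

/-- The polynomial `((x² - e)² - 30 d (x² - e) + 256 d²) / (2 d)`. -/
def tangentQuartic {k : Type*} [Field k] (d e : k) : k[X] :=
  C (2 * d)⁻¹ * ((X ^ 2 - C e) ^ 2 - C (30 * d) * (X ^ 2 - C e) + C (256 * d ^ 2))

/-- The polynomial `m x³ + n x`. -/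
def flexCubic {k : Type*} [Field k] (m n : k) : k[X] := C m * X ^ 3 + C n * X

namespace DoubleCover

variable {k F : Type*} [Field k] [Field F] [Algebra k F] {d : k} {f : k[X]} {x y : F}

theorem coeff_six_ne (S : DoubleCover d f x y) : f.coeff 6 ≠ 0 := by
  rw [← S.natDegree_eq]
  simpa using S.f_ne

theorem exists_atInfinity (S : DoubleCover d f x y) (hsq : ∀ a : k, ∃ b, b ^ 2 = a) :
    ∃ δ : k, δ ≠ 0 ∧ d * δ ^ 2 = f.coeff 6 := by
  obtain ⟨δ, hδ⟩ := hsq (f.coeff 6 / d)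
  have h : d * δ ^ 2 = f.coeff 6 := by rw [hδ, mul_div_cancel₀ _ S.d_ne]
  refine ⟨δ, ?_, h⟩
  rintro rfl
  exact S.coeff_six_ne (by rw [← h]; ring)

/-- Let `A`, `A'` lie over `(z, w) = (8, 24)` and `B`, `B'` over `(16, 16)` on `w² = z³ - 31 z² +
256 z`, where `x² - e = d z` and `y = d w`. With `∞ = P₁ + P₂`, the tangent function has divisor
`2(A + A') + (B + B') - 3∞` and the quartic one has divisor `4(B + B') - 4∞`. Eliminating `B + B'`
gives `8(A + A' - ∞)`. -/
theorem exists_divisor_order_eight (S : DoubleCover d f x y) (hsq : ∀ a : k, ∃ b, b ^ 2 = a)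
    (h3 : (3 : k) ≠ 0) {e : k}
    (hf : f = (X ^ 2 - C e) * ((X ^ 2 - C e) ^ 2 - C (31 * d) * (X ^ 2 - C e) + C (256 * d ^ 2))) :
    ∃ D : Divisor k F, Divisor.degree k F D = 0 ∧
      (∀ Q, 8 * D Q = Q.ord ((y - aeval x (tangentQuadratic d e)) ^ 4 /
        (y - aeval x (tangentQuartic d e)))) ∧
      4 • D ∉ Divisor.principal k F := by
  classical
  obtain ⟨δ, hδ0, hδ⟩ := S.exists_atInfinity hsq
  obtain ⟨P₁, h₁⟩ := S.exists_isPoint_atInfinity hδ hδ0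
  obtain ⟨P₂, h₂⟩ := S.exists_isPoint_atInfinity (δ := -δ) (by rw [neg_sq, hδ])
    (neg_ne_zero.2 hδ0)
  obtain ⟨r, hr⟩ := hsq (e + 8 * d)
  obtain ⟨q, hq⟩ := hsq (e + 16 * d)
  have hd := S.d_ne
  have h2 := S.two_ne
  have h24 : 24 * d ≠ 0 := by
    have : (24 : k) = 2 * 2 * 2 * 3 := by norm_num
    rw [this]; simp [h2, h3, hd]
  have h16 : 16 * d ≠ 0 := by
    have : (16 : k) = 2 * 2 * 2 * 2 := by norm_num
    rw [this]; simp [h2, hd]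
  have h4 : 4 * d ≠ 0 := by
    have : (4 : k) = 2 * 2 := by norm_num
    rw [this]; simp [h2, hd]
  have hfr : ∀ r' : k, r' ^ 2 = e + 8 * d → d * (24 * d) ^ 2 = f.eval r' := by
    intro r' hr'
    rw [hf]
    simp only [eval_mul, eval_add, eval_sub, eval_pow, eval_X, eval_C, hr']
    ring
  have hfq : ∀ q' : k, q' ^ 2 = e + 16 * d → d * (16 * d) ^ 2 = f.eval q' := by
    intro q' hq'
    rw [hf]
    simp only [eval_mul, eval_add, eval_sub, eval_pow, eval_X, eval_C, hq']
    ring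
  have h1r : ∀ r' : k, r' ^ 2 = e + 8 * d → (tangentQuadratic d e).eval r' = 24 * d := by
    intro r' hr'
    simp only [tangentQuadratic, eval_sub, eval_pow, eval_X, eval_C, hr']
    ring
  have h1q : ∀ q' : k, q' ^ 2 = e + 16 * d → (tangentQuadratic d e).eval q' = 16 * d := by
    intro q' hq'
    simp only [tangentQuadratic, eval_sub, eval_pow, eval_X, eval_C, hq']
    ring
  have h2q : ∀ q' : k, q' ^ 2 = e + 16 * d → (tangentQuartic d e).eval q' = 16 * d := by
    intro q' hq'
    simp only [tangentQuartic, eval_mul, eval_add, eval_sub, eval_pow, eval_X, eval_C, hq']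
    field_simp
    ring
  have hr' : (-r) ^ 2 = e + 8 * d := by rw [neg_sq, hr]
  have hq' : (-q) ^ 2 = e + 16 * d := by rw [neg_sq, hq]
  -- If `r = 0` or `q = 0`, the two points of a pair coincide; nothing below requires them to be
  -- distinct.
  obtain ⟨A, hA⟩ := S.exists_isPoint (hfr r hr) h24
  obtain ⟨A', hA'⟩ := S.exists_isPoint (hfr (-r) hr') h24
  obtain ⟨B, hB⟩ := S.exists_isPoint (hfq q hq) h16
  obtain ⟨B', hB'⟩ := S.exists_isPoint (hfq (-q) hq') h16
  have hXr : (X - C r) * (X - C (-r)) = X ^ 2 - C e - 8 * C d := by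
    have := congrArg C hr
    simp only [map_pow, map_add, map_mul, map_ofNat] at this
    rw [map_neg]
    linear_combination -this
  have hXq : (X - C q) * (X - C (-q)) = X ^ 2 - C e - 16 * C d := by
    have := congrArg C hq
    simp only [map_pow, map_add, map_mul, map_ofNat] at this
    rw [map_neg]
    linear_combination -this
  have hdiv1 := S.ord_sub_aeval (ι := Fin 4) (e := ![2, 2, 1, 1]) (a := ![r, -r, q, -q])
    (m := tangentQuadratic d e) (κ := 1) (A := ![A, A', B, B']) (n := 3) one_ne_zero
    (by
      simp only [Fin.prod_univ_four, Matrix.cons_val, C_1, one_mul, pow_one]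
      rw [show (X - C r) ^ 2 * (X - C (-r)) ^ 2 * (X - C q) * (X - C (-q)) =
        ((X - C r) * (X - C (-r))) ^ 2 * ((X - C q) * (X - C (-q))) by ring, hXr, hXq, hf,
        tangentQuadratic]
      simp only [map_mul, map_pow, map_ofNat]
      ring)
    (by
      intro i
      fin_cases i
      · simpa [h1r r hr] using hA
      · simpa [h1r (-r) hr'] using hA'
      · simpa [h1q q hq] using hB
      · simpa [h1q (-q) hq'] using hB')
    (by
      intro i
      fin_cases i
      · simpa [h1r r hr] using h24
      · simpa [h1r (-r) hr'] using h24
      · simpa [h1q q hq] using h16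
      · simpa [h1q (-q) hq'] using h16)
    le_rfl (by rw [tangentQuadratic]; compute_degree!) (by simp [Fin.sum_univ_four])
    hδ hδ0 h₁ h₂
  -- In the coordinate `z`, the norm is `-(z - 16)⁴ / 4` up to a power of `d`: with `v = z² - 30 z +
  -- 256` one has `4 z (v - z) - v² = -(v - 2 z)²`, and `v - 2 z = (z - 16)²`.
  have hdiv2 := S.ord_sub_aeval (ι := Fin 2) (e := ![4, 4]) (a := ![q, -q])
    (m := tangentQuartic d e) (κ := -(4 * d)⁻¹) (A := ![B, B']) (n := 4)
    (neg_ne_zero.2 (inv_ne_zero h4))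
    (by
      simp only [Fin.prod_univ_two, Matrix.cons_val]
      rw [← mul_pow, hXq, hf, tangentQuartic, mul_pow, ← C_pow, ← mul_assoc, ← C_mul]
      have h5 : d * (2 * d)⁻¹ ^ 2 = (4 * d)⁻¹ := by
        rw [show (4 : k) = 2 ^ 2 by norm_num]
        field_simp
      have h6 : C (4 * d)⁻¹ * (4 * C d) = 1 := by
        rw [← C_1, ← inv_mul_cancel₀ h4, C_mul, C_mul (a := 4), map_ofNat]
      rw [h5]
      simp only [map_mul, map_pow, map_ofNat, map_neg] at h6 ⊢
      linear_combination (-(X ^ 2 - C e) * ((X ^ 2 - C e) ^ 2 - 31 * C d * (X ^ 2 - C e)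
        + 256 * C d ^ 2)) * h6)
    (by
      intro i
      fin_cases i
      · simpa [h2q q hq] using hB
      · simpa [h2q (-q) hq'] using hB')
    (by
      intro i
      fin_cases i
      · simpa [h2q q hq] using h16
      · simpa [h2q (-q) hq'] using h16)
    (by norm_num)
    (by rw [tangentQuartic]; exact (natDegree_C_mul_le _ _).trans (by compute_degree!))
    (by simp [Fin.sum_univ_two]) hδ hδ0 h₁ h₂
  have hg1 := S.sub_aeval_ne_zero (tangentQuadratic d e)
  have hg2 := S.sub_aeval_ne_zero (tangentQuartic d e)
  simp only [Fin.sum_univ_four, Fin.sum_univ_two, Matrix.cons_val, Finsupp.sub_apply,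
    Finsupp.add_apply, Finsupp.smul_apply, Finsupp.single_apply] at hdiv1 hdiv2
  refine ⟨Divisor.pair A A' P₁ P₂, Divisor.degree_pair hA.degree_eq hA'.degree_eq h₁.degree_eq
    h₂.degree_eq, fun Q => ?_, ?_⟩
  · rw [div_eq_mul_inv, Q.ord_mul' (pow_ne_zero _ hg1) (inv_ne_zero hg2), Q.ord_pow,
      Q.ord_inv' hg2, hdiv1, hdiv2, Divisor.pair]
    simp only [Finsupp.sub_apply, Finsupp.add_apply, Finsupp.single_apply]
    push_cast
    split_ifs <;> norm_num
  · intro hmem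
    refine S.two_nsmul_pair_notMem hδ hδ0 h₁ h₂ hB hB' h16 (hfq q hq) ?_
    -- Twice the tangent relation: if `4(A + A' - ∞)` were principal, so would be `2(B + B' - ∞)`,
    -- which is impossible as `B` and `B'` share the `y`-coordinate `16 d ≠ 0`.
    have hp : 2 • (2 • Divisor.pair A A' P₁ P₂ + Divisor.pair B B' P₁ P₂)
        ∈ Divisor.principal k F := by
      refine AddSubgroup.nsmul_mem _ ?_ 2
      refine ⟨Units.mk0 _ hg1, fun Q => ?_⟩
      rw [Units.val_mk0, hdiv1, Divisor.pair, Divisor.pair]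
      simp only [Finsupp.sub_apply, Finsupp.add_apply, Finsupp.smul_apply, Finsupp.single_apply]
      push_cast
      split_ifs <;> norm_num
    have := sub_mem hp hmem
    convert this using 1
    module

/-- After division by `x³` the function takes the nonzero value `δ + m` at the point. -/
theorem _root_.Place.IsPoint.ord_add_flexCubic (S : DoubleCover d f x y) {P : Place k F} {δ : k}
    (hP : P.IsPoint x⁻¹ (y / x ^ 3) 0 δ) {m n : k} (hm : δ + m ≠ 0) :
    P.ord (y + aeval x (flexCubic m n)) = -3 := by
  have hx := S.x_ne
  have hx3 := pow_ne_zero 3 hx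
  have hg := S.add_aeval_ne_zero (flexCubic m n)
  have hu := hP.val_x
  rw [map_zero, sub_zero] at hu
  have h1 : P.val ((y + aeval x (flexCubic m n)) * (x ^ 3)⁻¹) = 1 := by
    refine P.val_eq_one_of_sub hm ?_
    have : (y + aeval x (flexCubic m n)) * (x ^ 3)⁻¹ - algebraMap k F (δ + m) =
        (y / x ^ 3 - algebraMap k F δ) + algebraMap k F n * (x⁻¹ * x⁻¹) := by
      simp only [flexCubic, map_add, map_mul, map_pow, aeval_C, aeval_X]
      field_simp
      ring
    rw [this]
    refine P.val.map_add_lt hP.val_y ?_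
    rw [map_mul, map_mul]
    exact (mul_le_of_le_one_left' (P.val_algebraMap_le n)).trans_lt
      ((mul_le_of_le_one_left' hu.le).trans_lt hu)
  rw [P.val_eq_one_iff (mul_ne_zero hg (inv_ne_zero hx3)), P.ord_mul' hg (inv_ne_zero hx3),
    P.ord_inv' hx3, P.ord_pow, hP.ord_x_atInfinity S] at h1
  push_cast at h1
  linarith

/-- The degenerate case in which the flex lies over `x = ∞`. The norm of `y - (m x³ + n x)` is
constant, so its divisor is supported at infinity: it is `3 P₁ - 3 P₂`. -/
theorem exists_divisor_order_three_of_eq_add (S : DoubleCover d f x y) {m n c : k} (hc : c ≠ 0)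
    (hf : f = C d * flexCubic m n ^ 2 + C c) :
    ∃ D : Divisor k F, Divisor.degree k F D = 0 ∧
      (∀ Q, 3 * D Q = Q.ord (y - aeval x (flexCubic m n))) ∧
      D ∉ Divisor.principal k F := by
  have hm6 : d * m ^ 2 = f.coeff 6 := by
    have : C d * (C m * X ^ 3 + C n * X) ^ 2 + C c =
      C (d * m ^ 2) * X ^ 6 + C (2 * d * m * n) * X ^ 4 + C (d * n ^ 2) * X ^ 2 + C c := by
      simp only [map_mul, map_pow, map_ofNat]
      ring
    rw [hf, flexCubic, this]
    simp only [coeff_add, coeff_C_mul, coeff_X_pow, coeff_C]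
    norm_num
  have hm0 : m ≠ 0 := by
    rintro rfl
    exact S.coeff_six_ne (by rw [← hm6]; ring)
  have h2m : 2 * m ≠ 0 := mul_ne_zero S.two_ne hm0
  obtain ⟨P₁, h₁⟩ := S.exists_isPoint_atInfinity hm6 hm0
  obtain ⟨P₂, h₂⟩ := S.exists_isPoint_atInfinity (δ := -m) (by rw [neg_sq, hm6])
    (neg_ne_zero.2 hm0)
  have hne := S.atInfinity_ne hm0 h₁ h₂
  have hN : f - C d * flexCubic m n ^ 2
      = C c * ∏ i : Fin 0, (X - C ((![] : Fin 0 → k) i)) ^ (![] : Fin 0 → ℕ) i := by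
    rw [hf]
    simp
  refine ⟨Finsupp.single P₁ 1 - Finsupp.single P₂ 1, ?_, fun Q => ?_,
    S.atInfinity_notMem hm6 hm0 h₁ h₂⟩
  · rw [map_sub, Divisor.degree_single, Divisor.degree_single, h₁.degree_eq, h₂.degree_eq, sub_self]
  rcases S.place_cases hm6 h₁ h₂ Q with hQ | rfl | rfl
  · rw [S.ord_sub_aeval_of_val_le hc hN (A := ![]) (fun i => i.elim0) (fun i => i.elim0) hQ]
    have hQ1 : Q ≠ P₁ := by
      rintro rfl
      exact absurd hQ (not_le.2 (h₁.one_lt_val_x S))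
    have hQ2 : Q ≠ P₂ := by
      rintro rfl
      exact absurd hQ (not_le.2 (h₂.one_lt_val_x S))
    simp [hQ1.symm, hQ2.symm]
  · have h3 := S.ord_norm hc hN Q
    rw [h₁.ord_add_flexCubic S (by rwa [← two_mul]), Finset.univ_eq_empty, Finset.sum_empty] at h3
    simp only [Finsupp.sub_apply, Finsupp.single_eq_same, Finsupp.single_eq_of_ne hne]
    linarith
  · have h3 := h₂.ord_add_flexCubic S (m := -m) (n := -n) (by
      rw [← two_mul, mul_neg]; exact neg_ne_zero.2 h2m)
    have h4 : flexCubic (-m) (-n) = -flexCubic m n := by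
      simp only [flexCubic, map_neg]
      ring
    rw [h4, map_neg, ← sub_eq_add_neg] at h3
    rw [h3]
    simp [hne]

/-- For `t ≠ 0` the norm of `y - (m x³ + n x)` is a cube with roots `x = ±ρ`, `ρ² = t⁻¹`, so its
divisor is `3(A + B - ∞)`, where `A` and `B` lie over the flex `x⁻² = t`. -/
theorem exists_divisor_order_three (S : DoubleCover d f x y) (hsq : ∀ a : k, ∃ b, b ^ 2 = a)
    {m n c t : k} (hf : f = C d * flexCubic m n ^ 2 + C c * (1 - C t * X ^ 2) ^ 3) :
    ∃ D : Divisor k F, Divisor.degree k F D = 0 ∧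
      (∀ Q, 3 * D Q = Q.ord (y - aeval x (flexCubic m n))) ∧
      D ∉ Divisor.principal k F := by
  classical
  have hc : c ≠ 0 := by
    have := S.coeff_zero_ne
    rw [coeff_zero_eq_eval_zero, hf] at this
    simpa [flexCubic] using this
  by_cases ht : t = 0
  · subst ht
    exact S.exists_divisor_order_three_of_eq_add (m := m) (n := n) hc (by rw [hf]; simp)
  obtain ⟨δ, hδ0, hδ⟩ := S.exists_atInfinity hsq
  obtain ⟨P₁, h₁⟩ := S.exists_isPoint_atInfinity hδ hδ0
  obtain ⟨P₂, h₂⟩ := S.exists_isPoint_atInfinity (δ := -δ) (by rw [neg_sq, hδ])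
    (neg_ne_zero.2 hδ0)
  obtain ⟨ρ, hρ⟩ := hsq t⁻¹
  have hρ' : (-ρ) ^ 2 = t⁻¹ := by rw [neg_sq, hρ]
  have hρ0 : ρ ≠ 0 := by
    rintro rfl
    exact inv_ne_zero ht (by rw [← hρ]; ring)
  have hfm : ∀ a : k, a ^ 2 = t⁻¹ → d * (flexCubic m n).eval a ^ 2 = f.eval a := by
    intro a ha
    rw [hf]
    simp [ha, ht]
  -- If the cubic vanished at `a`, then `f` would be a combination of a square and a cube both
  -- vanishing there, so `a` would be a multiple root.
  have hm0 : ∀ a : k, a ^ 2 = t⁻¹ → (flexCubic m n).eval a ≠ 0 := by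
    intro a ha h0
    have hd : (derivative f).eval a = 0 := by
      rw [hf]
      simp only [derivative_add, derivative_mul, derivative_pow, derivative_C, derivative_sub,
        derivative_one, eval_add, eval_mul, eval_pow, eval_sub, eval_C, eval_X, eval_one, h0, ha,
        mul_inv_cancel₀ ht]
      simp
    obtain ⟨u, v, huv⟩ := S.sep
    have := congrArg (eval a) huv
    rw [eval_add, eval_mul, eval_mul, hd, ← hfm a ha, h0] at this
    simp at this
  obtain ⟨A, hA⟩ := S.exists_isPoint (hfm ρ hρ) (hm0 ρ hρ)
  obtain ⟨B, hB⟩ := S.exists_isPoint (hfm (-ρ) hρ') (hm0 (-ρ) hρ')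
  have hX : (X - C ρ) * (X - C (-ρ)) = X ^ 2 - C t⁻¹ := by
    have := congrArg C hρ
    simp only [map_pow] at this
    rw [map_neg]
    linear_combination -this
  have hdiv := S.ord_sub_aeval (ι := Fin 2) (e := ![3, 3]) (a := ![ρ, -ρ])
    (m := flexCubic m n) (κ := -(c * t ^ 3)) (A := ![A, B]) (n := 3)
    (neg_ne_zero.2 (mul_ne_zero hc (pow_ne_zero 3 ht)))
    (by
      simp only [Fin.prod_univ_two, Matrix.cons_val]
      rw [← mul_pow, hX, hf]
      have h6 : C t * C t⁻¹ = 1 := by rw [← C_mul, mul_inv_cancel₀ ht, C_1]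
      have h7 : 1 - C t * X ^ 2 = - (C t * (X ^ 2 - C t⁻¹)) := by linear_combination -h6
      rw [h7]
      simp only [map_mul, map_pow, map_neg]
      ring)
    (by
      intro i
      fin_cases i
      · exact hA
      · exact hB)
    (by
      intro i
      fin_cases i
      · exact hm0 ρ hρ
      · exact hm0 (-ρ) hρ')
    le_rfl (by rw [flexCubic]; compute_degree!) (by simp [Fin.sum_univ_two]) hδ hδ0 h₁ h₂
  refine ⟨Divisor.pair A B P₁ P₂, Divisor.degree_pair hA.degree_eq hB.degree_eq h₁.degree_eq
    h₂.degree_eq, fun Q => ?_, S.pair_notMem hδ hδ0 h₁ h₂ hA hB ?_⟩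
  · rw [hdiv, Divisor.pair]
    simp only [Fin.sum_univ_two, Matrix.cons_val, Finsupp.sub_apply, Finsupp.add_apply,
      Finsupp.smul_apply, Finsupp.single_apply]
    push_cast
    split_ifs <;> norm_num
  · intro h
    exact mul_ne_zero S.two_ne hρ0 (by linear_combination h)

end DoubleCover
end

/-! ### The coordinate ring of a sextic model, nonsingularity and Galois action. -/

noncomputable section

namespace SexticModel

variable {K : Type*} [Field K]

theorem equation_eq (C : SexticModel K) (hd : C.d ≠ 0) :
    C.equation = Polynomial.C (Polynomial.C C.d) * (X ^ 2 -
      Polynomial.C (Polynomial.C C.d⁻¹ * C.sextic)) := by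
  rw [equation, mul_sub, ← Polynomial.C_mul, ← mul_assoc, ← Polynomial.C_mul, mul_inv_cancel₀ hd,
    Polynomial.C_1, one_mul]

theorem natDegree_equation (C : SexticModel K) (hd : C.d ≠ 0) : C.equation.natDegree = 2 := by
  rw [C.equation_eq hd, natDegree_C_mul (by simpa using hd), natDegree_X_pow_sub_C]

theorem leadingCoeff_equation (C : SexticModel K) (hd : C.d ≠ 0) :
    C.equation.leadingCoeff = Polynomial.C C.d := by
  rw [C.equation_eq hd, leadingCoeff_mul, leadingCoeff_X_pow_sub_C two_pos, leadingCoeff_C, mul_one]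

/-- Eisenstein's criterion at an irreducible factor of the sextic, which divides it only once. -/
theorem irreducible_equation (C : SexticModel K) (hd : C.d ≠ 0)
    (hsep : IsCoprime C.sextic (derivative C.sextic)) (hdeg : C.sextic.natDegree = 6) :
    Irreducible C.equation := by
  have h0 : C.sextic ≠ 0 := by
    intro h
    simp [h] at hdeg
  have hu : ¬ IsUnit C.sextic := by
    intro h
    rw [natDegree_eq_zero_of_isUnit h] at hdeg
    norm_num at hdeg
  obtain ⟨p, hp, hpf⟩ := WfDvdMonoid.exists_irreducible_factor hu h0
  have hdu : IsUnit (Polynomial.C C.d) := isUnit_C.2 (IsUnit.mk0 _ hd)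
  have hdeg2 : C.equation.degree = 2 := by
    have h := C.natDegree_equation hd
    exact (degree_eq_iff_natDegree_eq_of_pos two_pos).2 h
  have hPrime : (Ideal.span {p}).IsPrime := (Ideal.span_singleton_prime hp.ne_zero).2 hp.prime
  refine irreducible_of_eisenstein_criterion hPrime ?_ ?_ ?_ ?_ ?_
  · rw [C.leadingCoeff_equation hd]
    exact fun h => hPrime.ne_top (Ideal.eq_top_of_isUnit_mem _ h hdu)
  · intro n hn
    rw [hdeg2] at hn
    have hn' : n < 2 := by exact_mod_cast hn
    rw [Ideal.mem_span_singleton, equation]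
    interval_cases n
    · simpa using hpf
    · simp
  · rw [hdeg2]; norm_num
  · rw [Ideal.span_singleton_pow, Ideal.mem_span_singleton, equation]
    intro h
    refine hp.not_isUnit ((Polynomial.Separable.squarefree hsep) p ?_)
    rw [← sq]
    simpa using h
  · intro r hr
    have h := (C_dvd_iff_dvd_coeff r _).1 hr 2
    have h2 : C.equation.coeff 2 = Polynomial.C C.d := by
      rw [← C.leadingCoeff_equation hd, leadingCoeff, C.natDegree_equation hd]
    rw [h2] at h
    exact isUnit_of_dvd_unit h hdu

theorem isDomain (C : SexticModel K) (hd : C.d ≠ 0)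
    (hsep : IsCoprime C.sextic (derivative C.sextic)) (hdeg : C.sextic.natDegree = 6) :
    IsDomain C.CoordinateRing :=
  AdjoinRoot.isDomain_of_prime (C.irreducible_equation hd hsep hdeg).prime

/-- The coordinate function `x`. -/
def x (C : SexticModel K) : C.CoordinateRing := AdjoinRoot.of C.equation X

/-- The coordinate function `y`. -/
def y (C : SexticModel K) : C.CoordinateRing := AdjoinRoot.root C.equation

theorem aeval_x (C : SexticModel K) (p : K[X]) : aeval C.x p = AdjoinRoot.of C.equation p := by
  have : (aeval C.x : K[X] →ₐ[K] C.CoordinateRing) =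
      { AdjoinRoot.of C.equation with commutes' := fun _ => rfl } := by
    refine algHom_ext ?_
    rw [aeval_X]
    rfl
  rw [this]
  rfl

theorem eqn (C : SexticModel K) :
    algebraMap K C.CoordinateRing C.d * C.y ^ 2 = aeval C.x C.sextic := by
  rw [aeval_x]
  have : eval₂ (AdjoinRoot.of C.equation) (AdjoinRoot.root C.equation)
      (Polynomial.C (Polynomial.C C.d) * X ^ 2 - Polynomial.C C.sextic) = 0 :=
    AdjoinRoot.eval₂_root C.equation
  simp only [eval₂_sub, eval₂_mul, eval₂_C, eval₂_pow, eval₂_X] at this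
  exact sub_eq_zero.1 this

theorem exists_eq (C : SexticModel K) (hd : C.d ≠ 0) (g : C.CoordinateRing) :
    ∃ a b : K[X], g = aeval C.x a + aeval C.x b * C.y := by
  have hy : C.y ^ 2 = aeval C.x (Polynomial.C C.d⁻¹ * C.sextic) := by
    rw [map_mul, ← C.eqn, aeval_C, ← mul_assoc, ← map_mul, inv_mul_cancel₀ hd, map_one, one_mul]
  induction g using AdjoinRoot.induction_on with
  | ih p =>
    induction p using Polynomial.induction_on with
    | C a => exact ⟨a, 0, by simp [aeval_x]⟩
    | add p q hp hq =>
      obtain ⟨a, b, h⟩ := hp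
      obtain ⟨a', b', h'⟩ := hq
      exact ⟨a + a', b + b', by rw [map_add, h, h', map_add, map_add]; ring⟩
    | monomial n a h =>
      obtain ⟨u, v, h⟩ := h
      refine ⟨v * (Polynomial.C C.d⁻¹ * C.sextic), u, ?_⟩
      rw [pow_succ, ← mul_assoc, map_mul, h, AdjoinRoot.mk_X, map_mul (aeval C.x), ← hy]
      change (_ + _ * C.y) * C.y = _
      ring

theorem indep (C : SexticModel K) (hd : C.d ≠ 0) {a b : K[X]}
    (h : aeval C.x a + aeval C.x b * C.y = 0) : a = 0 ∧ b = 0 := by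
  have h1 : AdjoinRoot.mk C.equation (Polynomial.C a + Polynomial.C b * X) = 0 := by
    rw [map_add, map_mul, AdjoinRoot.mk_X]
    rwa [aeval_x, aeval_x] at h
  rw [AdjoinRoot.mk_eq_zero] at h1
  have h2 : Polynomial.C a + Polynomial.C b * X = 0 := by
    by_contra h0
    have := natDegree_le_of_dvd h1 h0
    rw [C.natDegree_equation hd, add_comm] at this
    have h3 := natDegree_linear_le (a := b) (b := a)
    omega
  have h4 := congrArg (coeff · 0) h2
  have h5 := congrArg (coeff · 1) h2
  simp [coeff_C] at h4 h5
  exact ⟨h4, h5⟩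

theorem doubleCover (C : SexticModel K) [IsDomain C.CoordinateRing] (h2 : (2 : K) ≠ 0)
    (hd : C.d ≠ 0) (hsep : IsCoprime C.sextic (derivative C.sextic))
    (hdeg : C.sextic.natDegree = 6) (h0 : C.sextic.coeff 0 ≠ 0) :
    DoubleCover C.d C.sextic (algebraMap C.CoordinateRing C.FunctionField C.x)
      (algebraMap C.CoordinateRing C.FunctionField C.y) where
  two_ne := h2
  d_ne := hd
  sep := hsep
  natDegree_eq := hdeg
  coeff_zero_ne := h0
  eqn := by
    rw [aeval_algebraMap_apply, ← C.eqn, map_mul, map_pow, ← IsScalarTower.algebraMap_apply]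
  indep a b h := by
    rw [aeval_algebraMap_apply, aeval_algebraMap_apply, ← map_mul, ← map_add] at h
    exact C.indep hd (IsFractionRing.injective C.CoordinateRing C.FunctionField
      (h.trans (map_zero _).symm))
  repr h := by
    obtain ⟨p, q, hq, rfl⟩ := IsFractionRing.div_surjective (A := C.CoordinateRing) h
    have hq0 := nonZeroDivisors.ne_zero hq
    obtain ⟨a, b, rfl⟩ := C.exists_eq hd q
    -- Multiplication by the conjugate turns the denominator into a polynomial in `x`.
    have hconj : aeval C.x a - aeval C.x b * C.y ≠ 0 := by
      intro h
      have := C.indep hd (a := a) (b := -b) (by rw [map_neg, ← h]; ring)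
      rw [this.1, neg_eq_zero.1 this.2] at hq0
      simp at hq0
    have hnorm : (aeval C.x a + aeval C.x b * C.y) * (aeval C.x a - aeval C.x b * C.y) =
        aeval C.x (a ^ 2 - b ^ 2 * (Polynomial.C C.d⁻¹ * C.sextic)) := by
      simp only [map_sub, map_mul, map_pow, ← C.eqn, aeval_C]
      have : algebraMap K C.CoordinateRing C.d⁻¹ * algebraMap K C.CoordinateRing C.d = 1 := by
        rw [← map_mul, inv_mul_cancel₀ hd, map_one]
      linear_combination aeval C.x b ^ 2 * C.y ^ 2 * this
    obtain ⟨u, v, e⟩ := C.exists_eq hd (p * (aeval C.x a - aeval C.x b * C.y))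
    refine ⟨u, v, a ^ 2 - b ^ 2 * (Polynomial.C C.d⁻¹ * C.sextic), ?_, ?_⟩
    · intro h
      rw [h, map_zero] at hnorm
      exact mul_ne_zero hq0 hconj hnorm
    · rw [aeval_algebraMap_apply, aeval_algebraMap_apply, aeval_algebraMap_apply, ← map_mul,
        ← map_add, ← e, ← hnorm, map_mul, map_mul, ← mul_assoc, div_mul_cancel₀]
      rw [Ne, FaithfulSMul.algebraMap_eq_zero_iff]
      exact hq0

theorem coordinateRingEquiv_y (C : SexticModel K) (σ : K ≃+* K) (h : C.map (σ : K →+* K) = C) :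
    C.coordinateRingEquiv σ h C.y = C.y := by
  rw [coordinateRingEquiv, AdjoinRoot.coe_mapRingEquiv, y, AdjoinRoot.map_root]

theorem coordinateRingEquiv_aeval (C : SexticModel K) (σ : K ≃+* K)
    (h : C.map (σ : K →+* K) = C) (p : K[X]) :
    C.coordinateRingEquiv σ h (aeval C.x p) = aeval C.x (p.map (σ : K →+* K)) := by
  rw [aeval_x, aeval_x, coordinateRingEquiv, AdjoinRoot.coe_mapRingEquiv, AdjoinRoot.map_of]
  rfl

theorem semilinearAut_sub_aeval (C : SexticModel K) [IsDomain C.CoordinateRing] (σ : K ≃+* K)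
    (h : C.map (σ : K →+* K) = C) {p : K[X]} (hp : p.map (σ : K →+* K) = p) :
    (C.semilinearAut σ h).toEquiv (algebraMap C.CoordinateRing C.FunctionField C.y -
        aeval (algebraMap C.CoordinateRing C.FunctionField C.x) p) =
      algebraMap C.CoordinateRing C.FunctionField C.y -
        aeval (algebraMap C.CoordinateRing C.FunctionField C.x) p := by
  rw [aeval_algebraMap_apply, ← map_sub]
  change IsFractionRing.ringEquivOfRingEquiv (C.coordinateRingEquiv σ h) _ = _
  rw [IsFractionRing.ringEquivOfRingEquiv_algebraMap, map_sub, coordinateRingEquiv_y,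
    coordinateRingEquiv_aeval, hp]

theorem sextic_atInfinity (C : SexticModel K) : C.atInfinity.sextic = C.sextic.reflect 6 := by
  simp only [sextic, atInfinity, Fin.sum_univ_seven, reflect_add, reflect_C_mul_X_pow,
    Function.comp]
  simp [revAt_le]
  ring

theorem affineNonsingular (C : SexticModel K) (h2 : (2 : K) ≠ 0) (hd : C.d ≠ 0)
    (hsep : IsCoprime C.sextic (derivative C.sextic)) : C.AffineNonsingular := by
  rintro x y hxy ⟨h1, h3⟩
  have hd' : algebraMap K (AlgebraicClosure K) C.d ≠ 0 := by simpa using hd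
  have h2' : (2 : AlgebraicClosure K) ≠ 0 := by
    have := (_root_.map_ne_zero (algebraMap K (AlgebraicClosure K))).2 h2
    rwa [map_ofNat] at this
  have hy : y = 0 := by simpa [hd', h2'] using h1
  rw [hy] at hxy
  obtain ⟨u, v, huv⟩ := hsep
  have := congrArg (aeval x) huv
  simp [← hxy, h3] at this

theorem isNonsingularGenusTwo (C : SexticModel K) (h2 : (2 : K) ≠ 0)
    (hd : C.d ≠ 0) (hsep : IsCoprime C.sextic (derivative C.sextic))
    (hdeg : C.sextic.natDegree = 6) (h0 : C.sextic.coeff 0 ≠ 0) : C.IsNonsingularGenusTwo where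
  geometricallyIntegral := by
    refine isDomain _ ?_ ?_ ?_
    · simpa [map] using hd
    · rw [sextic_map, derivative_map]
      exact hsep.map (mapRingHom (algebraMap K (AlgebraicClosure K)))
    · rw [sextic_map, natDegree_map, hdeg]
  nonsingular := C.affineNonsingular h2 hd hsep
  nonsingular_atInfinity := by
    refine C.atInfinity.affineNonsingular h2 hd ?_
    rw [sextic_atInfinity]
    exact DoubleCover.isCoprime_reflect hsep hdeg
  genus_eq := by
    have := C.isDomain hd hsep hdeg
    exact (C.doubleCover h2 hd hsep hdeg h0).genus_eq

end SexticModel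
end

/-! ### Separability, descent to `K`, and the family. -/

noncomputable section

theorem map_tangentQuadratic {k l : Type*} [Field k] [Field l] (φ : k →+* l) (d e : k) :
    (tangentQuadratic d e).map φ = tangentQuadratic (φ d) (φ e) := by
  simp [tangentQuadratic, Polynomial.map_sub, _root_.map_ofNat]

theorem map_tangentQuartic {k l : Type*} [Field k] [Field l] (φ : k →+* l) (d e : k) :
    (tangentQuartic d e).map φ = tangentQuartic (φ d) (φ e) := by
  simp [tangentQuartic, _root_.map_ofNat]

theorem map_flexCubic {k l : Type*} [Field k] [Field l] (φ : k →+* l) (m n : k) :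
    (flexCubic m n).map φ = flexCubic (φ m) (φ n) := by
  simp [flexCubic]

theorem DivisorClass.nsmul_mk_eq_zero {k F : Type*} [Field k] [Field F] [Algebra k F]
    {D : Divisor k F} {n : ℕ} {g : F} (hg : g ≠ 0) (h : ∀ Q, n * D Q = Q.ord g) :
    n • (QuotientAddGroup.mk D : DivisorClass k F) = 0 := by
  rw [← QuotientAddGroup.mk_nsmul, QuotientAddGroup.eq_zero_iff]
  exact ⟨Units.mk0 g hg, fun Q => by rw [Units.val_mk0, ← h, Finsupp.smul_apply, nsmul_eq_mul]⟩

/-- The sextic in `x² = e + d z` obtained from the cubic `z³ - 31 z² + 256 z` is separable. -/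
theorem isCoprime_derivative_of_eq {k : Type*} [Field k] {d e : k} {f : k[X]} (h2 : (2 : k) ≠ 0)
    (h3 : (3 : k) ≠ 0) (h7 : (7 : k) ≠ 0) (hd : d ≠ 0) (h0 : f.coeff 0 ≠ 0)
    (hf : f = (X ^ 2 - C e) * ((X ^ 2 - C e) ^ 2 - C (31 * d) * (X ^ 2 - C e) + C (256 * d ^ 2))) :
    IsCoprime f (derivative f) := by
  obtain ⟨T, hT⟩ : ∃ T : k[X], T = X ^ 2 - C e := ⟨_, rfl⟩
  have hT' : derivative T = 2 * X := by
    rw [hT, derivative_sub, derivative_X_pow, derivative_C]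
    simp [_root_.map_ofNat]
  rw [← hT] at hf
  have hf' : derivative f = (2 * X) * (3 * T ^ 2 - 62 * C d * T + 256 * C d ^ 2) := by
    rw [hf]
    simp only [derivative_mul, derivative_add, derivative_sub, derivative_pow, derivative_C, hT',
      map_mul, map_pow, map_ofNat, Nat.cast_ofNat]
    simp
    ring
  have hX : IsCoprime f X := by
    refine (irreducible_X.coprime_iff_not_dvd.2 ?_).symm
    rwa [X_dvd_iff]
  have h2u : IsUnit (2 : k[X]) := by
    have := isUnit_C.2 (IsUnit.mk0 (2 : k) h2)
    rwa [map_ofNat] at this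
  rw [hf']
  refine IsCoprime.mul_right ((isCoprime_mul_unit_left_right h2u _ _).2 hX) ?_
  -- The cubic `T³ + p T² + q T` has discriminant `q² (p² - 4 q) = -63 · 256² d⁶`, since `31² - 4 ·
  -- 256 = -63`. The Bézout combination below produces -3 times it, which accounts for the primes 2,
  -- 3 and 7.
  have hc : (3 * 63 * 256 ^ 2 * d ^ 6 : k) ≠ 0 := by
    have e1 : (63 : k) = 3 * 3 * 7 := by norm_num
    have e2 : (256 : k) = 2 ^ 8 := by norm_num
    rw [e1, e2]
    simp [h2, h3, h7, hd]
  have hcC : C (3 * 63 * 256 ^ 2 * d ^ 6 : k)⁻¹ * (3 * 63 * 256 ^ 2 * C d ^ 6) = 1 := by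
    rw [← C_1, ← inv_mul_cancel₀ hc, C_mul]
    simp only [map_mul, map_pow, map_ofNat]
  set p : k[X] := -31 * C d
  set q : k[X] := 256 * C d ^ 2
  set α : k[X] := 6 * q - 2 * p ^ 2
  refine ⟨-C (3 * 63 * 256 ^ 2 * d ^ 6 : k)⁻¹ * (-(3 * T + 2 * p) * (9 * p * T - 3 * α)),
    -C (3 * 63 * 256 ^ 2 * d ^ 6 : k)⁻¹ * (3 * q * (p ^ 2 - 4 * q)
      - (3 * T + 2 * p) * (α * T - 3 * p * T ^ 2 - p ^ 2 * T)), ?_⟩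
  rw [hf]
  simp only [map_mul, map_pow, map_ofNat] at hcC ⊢
  rw [← hcC]
  simp only [p, q, α]
  ring

namespace SexticModel

variable {K : Type*} [Field K]

theorem galoisAction_mk_eq_self (C : SexticModel K) [IsDomain C.sepBaseChange.CoordinateRing]
    {D : Divisor (SeparableClosure K) C.sepBaseChange.FunctionField} {n : ℕ} (hn : n ≠ 0)
    {g : C.sepBaseChange.FunctionField} (hD : ∀ Q, n * D Q = Q.ord g)
    (σ : SeparableClosure K ≃ₐ[K] SeparableClosure K)
    (hg : (C.sepBaseChange.semilinearAut (σ : SeparableClosure K ≃+* SeparableClosure K)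
      (C.sepBaseChange_map σ)).toEquiv g = g) :
    C.galoisAction σ (QuotientAddGroup.mk D) = QuotientAddGroup.mk D := by
  change QuotientAddGroup.mk (SemilinearAut.divisorMap _ D) = _
  rw [SemilinearAut.divisorMap_eq_self _ (n := n) (by exact_mod_cast hn) hg hD]

/-- The two expressions of the sextic give classes of orders 8 and 3, and coprime orders multiply in
the sum. Both classes are rational because the functions cutting them out have coefficients in `K`.
-/
theorem exists_jacobianPoints_addOrderOf_eq (C : SexticModel K) (h2 : (2 : K) ≠ 0)
    (h3 : (3 : K) ≠ 0) (hd : C.d ≠ 0) (hsep : IsCoprime C.sextic (derivative C.sextic))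
    (hdeg : C.sextic.natDegree = 6) (h0 : C.sextic.coeff 0 ≠ 0) {e m n c t : K}
    (hf : C.sextic = (X ^ 2 - Polynomial.C e) * ((X ^ 2 - Polynomial.C e) ^ 2
      - Polynomial.C (31 * C.d) * (X ^ 2 - Polynomial.C e) + Polynomial.C (256 * C.d ^ 2)))
    (hf' : C.sextic = Polynomial.C C.d * flexCubic m n ^ 2
      + Polynomial.C c * (1 - Polynomial.C t * X ^ 2) ^ 3) :
    ∃ P : C.jacobianPoints, addOrderOf P = 24 := by
  set ι := algebraMap K (SeparableClosure K) with hι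
  have h2' : (2 : SeparableClosure K) ≠ 0 := by
    have := (_root_.map_ne_zero ι).2 h2
    rwa [map_ofNat] at this
  have h3' : (3 : SeparableClosure K) ≠ 0 := by
    have := (_root_.map_ne_zero ι).2 h3
    rwa [map_ofNat] at this
  have hd' : C.sepBaseChange.d ≠ 0 := (_root_.map_ne_zero ι).2 hd
  have hs : C.sepBaseChange.sextic = C.sextic.map ι := sextic_map _ _
  have hsep' : IsCoprime C.sepBaseChange.sextic (derivative C.sepBaseChange.sextic) := by
    rw [hs, derivative_map]
    exact hsep.map (mapRingHom ι)
  have hdeg' : C.sepBaseChange.sextic.natDegree = 6 := by rw [hs, natDegree_map, hdeg]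
  have h0' : C.sepBaseChange.sextic.coeff 0 ≠ 0 := by
    rw [hs, coeff_map]
    exact (_root_.map_ne_zero ι).2 h0
  have := C.sepBaseChange.isDomain hd' hsep' hdeg'
  have S := C.sepBaseChange.doubleCover h2' hd' hsep' hdeg' h0'
  -- Square roots are separable outside characteristic 2, so the separable closure contains all
  -- points used.
  have hsq : ∀ a : SeparableClosure K, ∃ b, b ^ 2 = a := fun a => by
    have : NeZero ((2 : ℕ) : SeparableClosure K) := ⟨by exact_mod_cast h2'⟩
    exact IsSepClosed.exists_pow_nat_eq a 2
  have hdι : C.sepBaseChange.d = ι C.d := rfl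
  obtain ⟨D, hD, hD8, hD4⟩ := S.exists_divisor_order_eight hsq h3' (e := ι e) (by
    rw [hs, hf, hdι]
    simp [Polynomial.map_sub, _root_.map_ofNat])
  obtain ⟨E, hE, hE3, hE1⟩ := S.exists_divisor_order_three hsq (m := ι m) (n := ι n) (c := ι c)
    (t := ι t) (by
      rw [hs, hf', hdι]
      simp [Polynomial.map_sub, map_flexCubic])
  have hg1 := S.sub_aeval_ne_zero (tangentQuadratic C.sepBaseChange.d (ι e))
  have hg2 := S.sub_aeval_ne_zero (tangentQuartic C.sepBaseChange.d (ι e))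
  have hσ : ∀ (σ : SeparableClosure K ≃ₐ[K] SeparableClosure K) (p : K[X]),
      (p.map ι).map ((σ : SeparableClosure K ≃+* SeparableClosure K) :
        SeparableClosure K →+* SeparableClosure K) = p.map ι := by
    intro σ p
    rw [Polynomial.map_map]
    congr 1
    exact RingHom.ext fun a => σ.commutes a
  have hσ' := fun σ p => C.sepBaseChange.semilinearAut_sub_aeval _ (C.sepBaseChange_map σ) (hσ σ p)
  have hDJ : (QuotientAddGroup.mk D : DivisorClass _ _) ∈ C.jacobianPoints := by
    refine ⟨⟨D, hD, rfl⟩, fun σ => C.galoisAction_mk_eq_self (n := 8) (by norm_num)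
      (by exact_mod_cast hD8) σ ?_⟩
    rw [map_div₀, map_pow, hdι, ← map_tangentQuadratic, ← map_tangentQuartic, hσ', hσ']
  have hEJ : (QuotientAddGroup.mk E : DivisorClass _ _) ∈ C.jacobianPoints := by
    refine ⟨⟨E, hE, rfl⟩, fun σ => C.galoisAction_mk_eq_self (n := 3) (by norm_num)
      (by exact_mod_cast hE3) σ ?_⟩
    rw [← map_flexCubic, hσ']
  refine ⟨⟨QuotientAddGroup.mk D + QuotientAddGroup.mk E, add_mem hDJ hEJ⟩, ?_⟩
  rw [← AddSubgroup.addOrderOf_coe]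
  have o8 : addOrderOf (QuotientAddGroup.mk D :
      DivisorClass (SeparableClosure K) C.sepBaseChange.FunctionField) = 2 ^ (2 + 1) := by
    refine addOrderOf_eq_prime_pow ?_ ?_
    · rw [← QuotientAddGroup.mk_nsmul, QuotientAddGroup.eq_zero_iff]
      exact hD4
    · exact DivisorClass.nsmul_mk_eq_zero (div_ne_zero (pow_ne_zero 4 hg1) hg2)
        (by exact_mod_cast hD8)
  have o3 : addOrderOf (QuotientAddGroup.mk E :
      DivisorClass (SeparableClosure K) C.sepBaseChange.FunctionField) = 3 := by
    refine addOrderOf_eq_prime ?_ ?_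
    · exact DivisorClass.nsmul_mk_eq_zero (S.sub_aeval_ne_zero _) (by exact_mod_cast hE3)
    · rw [Ne, QuotientAddGroup.eq_zero_iff]
      exact hE1
  rw [(AddCommute.all _ _).addOrderOf_add_eq_mul_addOrderOf_of_coprime (by rw [o8, o3]; norm_num),
    o8, o3]
  norm_num

end SexticModel

theorem ringChar_ne_imp {K : Type*} [Field K] {p : ℕ} (hp : p.Prime) (h : ringChar K ≠ p) :
    (p : K) ≠ 0 := by
  intro h0
  have := (Nat.dvd_prime hp).1 (ringChar.dvd h0)
  rcases this with h1 | h1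
  · exact CharP.ringChar_ne_one h1
  · exact h h1

end

theorem theoremT {K : Type*} [Field K]
    (h2 : ringChar K ≠ 2) (h3 : ringChar K ≠ 3) (h7 : ringChar K ≠ 7)
    (s c₄ c₂ c₀ d : K)
    (hc₄ : c₄ = -31 * s ^ 4 - 1302 * s ^ 2 + (32200 / 3) * s + 4557)
    (hc₂ : c₂ = 2 ^ 8 * (s ^ 8 + 84 * s ^ 6 - (3472 / 3) * s ^ 5 + 1470 * s ^ 4
      - 48608 * s ^ 3 + 53508 * s ^ 2 + 170128 * s + 21609))
    (hc₀ : c₀ = (2 ^ 20 * 7 / 3) * s * (s ^ 2 + 7) ^ 3 * (s ^ 2 + 63))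
    (hd : d = s ^ 4 + 42 * s ^ 2 + (1736 / 3) * s - 147)
    (hne : c₀ * d ≠ 0) :
    (⟨d, ![c₀, 0, c₂, 0, c₄, 0, 1]⟩ : SexticModel K).IsNonsingularGenusTwo ∧
      ∃ P : (⟨d, ![c₀, 0, c₂, 0, c₄, 0, 1]⟩ : SexticModel K).jacobianPoints,
        addOrderOf P = 24 := by
  have h2' : (2 : K) ≠ 0 := by exact_mod_cast ringChar_ne_imp Nat.prime_two h2
  have h3' : (3 : K) ≠ 0 := by exact_mod_cast ringChar_ne_imp Nat.prime_three h3
  have h7' : (7 : K) ≠ 0 := by exact_mod_cast ringChar_ne_imp (by norm_num : Nat.Prime 7) h7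
  have hc0 : c₀ ≠ 0 := left_ne_zero_of_mul hne
  have hd0 : d ≠ 0 := right_ne_zero_of_mul hne
  have hs : s ≠ 0 := by
    rintro rfl
    exact hc0 (by rw [hc₀]; ring)
  have hs7 : s ^ 2 + 7 ≠ 0 := by
    intro h
    exact hc0 (by rw [hc₀, h]; ring)
  have hs63 : s ^ 2 + 63 ≠ 0 := by
    intro h
    exact hc0 (by rw [hc₀, h]; ring)
  set C : SexticModel K := ⟨d, ![c₀, 0, c₂, 0, c₄, 0, 1]⟩ with hC
  have hsx : C.sextic = X ^ 6 + Polynomial.C c₄ * X ^ 4 + Polynomial.C c₂ * X ^ 2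
      + Polynomial.C c₀ := by
    simp [SexticModel.sextic, hC, Fin.sum_univ_seven]
    ring
  have hdeg : C.sextic.natDegree = 6 := by
    rw [hsx]
    compute_degree!
  have h0 : C.sextic.coeff 0 ≠ 0 := by
    rw [hsx]
    simpa using hc0
  -- Here `28672 = 2¹² · 7`. The constant term is `-e (e² + 31 d e + 256 d²)`, and for this `e` the
  -- second factor is `2⁸ (s² + 7)³ (s² + 63)`.
  obtain ⟨e, he⟩ : ∃ e, e = -(28672 / 3) * s := ⟨_, rfl⟩
  have hf : C.sextic = (X ^ 2 - Polynomial.C e) * ((X ^ 2 - Polynomial.C e) ^ 2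
      - Polynomial.C (31 * d) * (X ^ 2 - Polynomial.C e) + Polynomial.C (256 * d ^ 2)) := by
    have e4 : c₄ = -3 * e - 31 * d := by rw [hc₄, he, hd]; field_simp; ring
    have e2 : c₂ = 3 * e ^ 2 + 62 * d * e + 256 * d ^ 2 := by rw [hc₂, he, hd]; field_simp; ring
    have e0 : c₀ = -e ^ 3 - 31 * d * e ^ 2 - 256 * d ^ 2 * e := by
      rw [hc₀, he, hd]; field_simp; ring
    rw [hsx, e4, e2, e0]
    simp only [map_add, map_sub, map_mul, map_neg, map_pow, map_ofNat]
    ring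
  -- On `d w² = c₀ u³ + c₂ u² + c₄ u + 1` the flex has `u = t` and tangent `w = m + n u`. The
  -- denominators of `t` and `m` are nonzero because their factors other than powers of 2 divide
  -- `c₀`.
  obtain ⟨t, ht⟩ : ∃ t, t = -(3 * s ^ 2 - 62 * s + 63) / (2 ^ 10 * s * (s ^ 2 + 7) * (s ^ 2 + 63)) :=
    ⟨_, rfl⟩
  obtain ⟨m, hm⟩ : ∃ m, m = -(31 * s + 63) / (2 ^ 5 * s * (s ^ 2 + 63)) := ⟨_, rfl⟩
  obtain ⟨n, hn⟩ : ∃ n, n = 16 * (s ^ 2 - 21) := ⟨_, rfl⟩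
  have hf' : C.sextic = Polynomial.C d * flexCubic m n ^ 2
      + Polynomial.C c₀ * (1 - Polynomial.C t * X ^ 2) ^ 3 := by
    have e6 : 1 = d * m ^ 2 - c₀ * t ^ 3 := by rw [hc₀, hd, hm, ht]; field_simp; ring
    have e4 : c₄ = 2 * d * m * n + 3 * c₀ * t ^ 2 := by
      rw [hc₄, hc₀, hd, hm, hn, ht]; field_simp; ring
    have e2 : c₂ = d * n ^ 2 - 3 * c₀ * t := by rw [hc₂, hc₀, hd, hn, ht]; field_simp; ring
    have e6' := congrArg Polynomial.C e6
    have e4' := congrArg Polynomial.C e4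
    have e2' := congrArg Polynomial.C e2
    simp only [map_add, map_sub, map_mul, map_pow, map_ofNat, map_one] at e6' e4' e2'
    rw [hsx, flexCubic]
    linear_combination X ^ 6 * e6' + X ^ 4 * e4' + X ^ 2 * e2'
  have hsep := isCoprime_derivative_of_eq h2' h3' h7' hd0 h0 hf
  exact ⟨C.isNonsingularGenusTwo h2' hd0 hsep hdeg h0,
    C.exists_jacobianPoints_addOrderOf_eq h2' h3' hd0 hsep hdeg h0 hf hf'⟩
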